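/- Let $k$ be an algebraically closed field, let $d \geqslant 1$ be an integer, and let $\mathscr{T}$ be a $k$-linear, Hom-finite $(d+2)$-angulated category (in the sense of Geiss–Keller–Oppermann) with split idempotents and with ($k$-linear) $d$-suspension functor $\Sigma^d$. Write $\Sigma^{2d} = \Sigma^d \circ \Sigma^d$ and $\operatorname{Ext}^d_{\mathscr{T}}(X,Y) = \mathscr{T}(X,\Sigma^d Y)$. Assume that $\mathscr{T}$ is $2d$-Calabi–Yau, that is, $\mathscr{T}(X,Y) \cong \operatorname{Hom}_k(\mathscr{T}(Y,\Sigma^{2d}X),k)$ naturally in $X,Y \in \mathscr{T}$. Let $T \in \mathscr{T}$ be an Oppermann–Thomas cluster tilting object: $\operatorname{Ext}^d_{\mathscr{T}}(T,T) = 0$, and for each $Y \in \mathscr{T}$ there is a $(d+2)$-angle $T_d \to \cdots \to T_0 \to Y \to \Sigma^d T_d$ with all $T_i \in \operatorname{add} T$. Let $\Gamma = \operatorname{End}_{\mathscr{T}}(T)$, and let $\operatorname{mod}\Gamma$ be the category of finitely generated right $\Gamma$-modules. Let $\tau_d = \tau\,\Omega^{d-1}$ be the $d$-Auslander–Reiten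 translation on $\operatorname{mod}\Gamma$; that is, $\tau_d M$ is the kernel of $\nu_\Gamma P_d \to \nu_\Gamma P_{d-1}$, where $\cdots \to P_1 \to P_0 \to M \to 0$ is the augmented minimal projective resolution of $M$ and $\nu_\Gamma = \operatorname{Hom}_k(\operatorname{Hom}_\Gamma(-,\Gamma),k)$ is the Nakayama functor. For each $X \in \mathscr{T}$, pick an isomorphism $X \cong X' \oplus X''$ such that $X'$ has no non-zero direct summands in $\operatorname{add}\Sigma^d T$ and $X'' \in \operatorname{add}\Sigma^d T$, and set $\Delta(X) = \big(\mathscr{T}(T,X'),\, \mathscr{T}(T,\Sigma^{-d}X'')\big)$, a pair of modules in $\operatorname{mod}\Gamma$. Given $X, Y \in \mathscr{T}$, set $(M,P) = \Delta(X)$ and $(N,Q) = \Delta(Y)$. Then $$ \dim_k \operatorname{Ext}^d_{\mathscr{T}}(X,Y) = \dim_k \operatorname{Hom}_\Gamma(M,\tau_d N) + \dim_k \operatorname{Hom}_\Gamma(N,\tau_d M) + \dim_k \operatorname{Hom}_\Gamma(P,N) + \dim_k \operatorname{Hom}_\Gamma(Q,M). $$ Consequently, $\operatorname{Ext}^d_{\mathscr{T}}(X,Y)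 = 0$ if and only if $$ \operatorname{Hom}_\Gamma(M,\tau_d N) = \operatorname{Hom}_\Gamma(N,\tau_d M) = \operatorname{Hom}_\Gamma(P,N) = \operatorname{Hom}_\Gamma(Q,M) = 0. $$ -/

import Mathlib

open CategoryTheory CategoryTheory.Limits

universe v u w

noncomputable section

namespace HigherAngulated

/-! ### Sequences and `(d+2)`-angulations -/

section Sequences

variable {C : Type u} [Category.{v} C] [Preadditive C]

/-- A `(d+2)`-`S`-sequence `X₀ ⟶ X₁ ⟶ ⋯ ⟶ X_{d+1} ⟶ S X₀` (the objects are numbered from `0`). -/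
structure Seq (S : C ⥤ C) (d : ℕ) where
  X : Fin (d + 2) → C
  f : ∀ (i : ℕ) (h : i < d + 1), X ⟨i, by omega⟩ ⟶ X ⟨i + 1, by omega⟩
  δ : X ⟨d + 1, by omega⟩ ⟶ S.obj (X ⟨0, by omega⟩)

namespace Seq

variable {S : C ⥤ C} {d : ℕ}

/-- A morphism of `(d+2)`-`S`-sequences: `(φ₀, …, φ_{d+1})` making all squares commute, the last
square having `S φ₀` on the right. -/
structure Hom (A B : Seq S d) where
  φ : ∀ i, A.X i ⟶ B.X i
  comm : ∀ (i : ℕ) (h : i < d + 1),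
    A.f i h ≫ φ ⟨i + 1, by omega⟩ = φ ⟨i, by omega⟩ ≫ B.f i h
  comm_last : A.δ ≫ S.map (φ ⟨0, by omega⟩) = φ ⟨d + 1, by omega⟩ ≫ B.δ

/-- Two sequences are isomorphic if there is a morphism between them all of whose components are
isomorphisms. -/
def Isomorphic (A B : Seq S d) : Prop :=
  ∃ Φ : Hom A B, ∀ i, IsIso (Φ.φ i)

/-- The direct sum of two sequences. -/
def sum [HasBinaryBiproducts C] (A B : Seq S d) : Seq S d where
  X i := A.X i ⊞ B.X i
  f i h := biprod.map (A.f i h) (B.f i h)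
  δ := biprod.desc (A.δ ≫ S.map biprod.inl) (B.δ ≫ S.map biprod.inr)

/-- `A` is, up to isomorphism, the trivial sequence `Z = Z ⟶ 0 ⟶ ⋯ ⟶ 0 ⟶ S Z`. (For `1 ≤ d` the
object `X_{d+1}` vanishes, so that the last morphism is automatically zero.) -/
def IsTrivial (A : Seq S d) : Prop :=
  IsIso (A.f 0 (by omega)) ∧ ∀ i : Fin (d + 2), 2 ≤ i.val → IsZero (A.X i)

/-- `B` is, up to isomorphism, the left rotation
`X₁ ⟶ X₂ ⟶ ⋯ ⟶ X_{d+1} ⟶ S X₀ ⟶ S X₁` of `A`, whose last morphism is `(-1)^(d+2) S f₀`. -/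
def IsLeftRotation (A B : Seq S d) : Prop :=
  ∃ (u : ∀ (i : ℕ) (h : i < d + 1), B.X ⟨i, by omega⟩ ≅ A.X ⟨i + 1, by omega⟩)
    (w : B.X ⟨d + 1, by omega⟩ ≅ S.obj (A.X ⟨0, by omega⟩)),
    (∀ (i : ℕ) (h : i < d),
      B.f i (by omega) ≫ (u (i + 1) (by omega)).hom
        = (u i (by omega)).hom ≫ A.f (i + 1) (by omega)) ∧
    B.f d (by omega) ≫ w.hom = (u d (by omega)).hom ≫ A.δ ∧
    B.δ ≫ S.map (u 0 (by omega)).hom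
      = w.hom ≫ ((-1 : ℤ) ^ (d + 2) • S.map (A.f 0 (by omega)))

/-- `E` is, up to isomorphism, the mapping cone
`A₁ ⊞ B₀ ⟶ A₂ ⊞ B₁ ⟶ ⋯ ⟶ A_{d+1} ⊞ B_d ⟶ S A₀ ⊞ B_{d+1} ⟶ S A₁ ⊞ S B₀`
of `Φ : A ⟶ B`, with morphisms `(-a_{i+1}, 0; φ_{i+1}, b_i)` for `i < d`, then
`(-a_last, 0; φ_{d+1}, b_d)` and finally `(-S a₀, 0; S φ₀, b_last)`. The last morphism is
expressed through its two components, because `S (A₁ ⊞ B₀)` is only isomorphic to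
`S A₁ ⊞ S B₀`. -/
def IsCone [HasBinaryBiproducts C] {A B : Seq S d} (Φ : Hom A B) (E : Seq S d) : Prop :=
  ∃ (u : ∀ (i : ℕ) (h : i < d + 1),
        E.X ⟨i, by omega⟩ ≅ A.X ⟨i + 1, by omega⟩ ⊞ B.X ⟨i, by omega⟩)
    (w : E.X ⟨d + 1, by omega⟩ ≅ S.obj (A.X ⟨0, by omega⟩) ⊞ B.X ⟨d + 1, by omega⟩),
    (∀ (i : ℕ) (h : i < d),
      E.f i (by omega) ≫ (u (i + 1) (by omega)).hom
        = (u i (by omega)).hom ≫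
          Biprod.ofComponents (-A.f (i + 1) (by omega)) (Φ.φ ⟨i + 1, by omega⟩)
            0 (B.f i (by omega))) ∧
    E.f d (by omega) ≫ w.hom
      = (u d (by omega)).hom ≫
        Biprod.ofComponents (-A.δ) (Φ.φ ⟨d + 1, by omega⟩) 0 (B.f d (by omega)) ∧
    E.δ ≫ S.map ((u 0 (by omega)).hom ≫ biprod.fst)
      = w.hom ≫ biprod.desc (-S.map (A.f 0 (by omega))) 0 ∧
    E.δ ≫ S.map ((u 0 (by omega)).hom ≫ biprod.snd)
      = w.hom ≫ biprod.desc (S.map (Φ.φ ⟨0, by omega⟩)) B.δ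

end Seq

/-- A `(d+2)`-angulation of `(C, S)` in the sense of Geiss, Keller and Oppermann: a class of
`(d+2)`-`S`-sequences, called `(d+2)`-angles, satisfying their axioms (F1)-(F4). -/
structure Angulation [HasBinaryBiproducts C] (S : C ⥤ C) (d : ℕ) where
  IsAngle : Seq S d → Prop
  /-- (F1)(a): closed under isomorphisms, direct sums and direct summands. -/
  of_iso : ∀ A B, A.Isomorphic B → IsAngle A → IsAngle B
  sum : ∀ A B, IsAngle A → IsAngle B → IsAngle (A.sum B)
  of_sum : ∀ A B, IsAngle (A.sum B) → IsAngle A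
  /-- (F1)(b): trivial sequences are angles. -/
  trivial : ∀ A, A.IsTrivial → IsAngle A
  /-- (F1)(c): each morphism is the first morphism of an angle. -/
  exists_angle : ∀ {Y Z : C} (α : Y ⟶ Z), ∃ A, IsAngle A ∧
    ∃ (u : A.X ⟨0, by omega⟩ ≅ Y) (w : A.X ⟨1, by omega⟩ ≅ Z),
      A.f 0 (by omega) ≫ w.hom = u.hom ≫ α
  /-- (F2): a sequence is an angle if and only if its left rotation is. -/
  rotate : ∀ A B, A.IsLeftRotation B → (IsAngle A ↔ IsAngle B)
  /-- (F3): a commutative square on the first morphisms extends to a morphism of angles. -/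
  complete : ∀ A B, IsAngle A → IsAngle B →
    ∀ (φ₀ : A.X ⟨0, by omega⟩ ⟶ B.X ⟨0, by omega⟩) (φ₁ : A.X ⟨1, by omega⟩ ⟶ B.X ⟨1, by omega⟩),
      A.f 0 (by omega) ≫ φ₁ = φ₀ ≫ B.f 0 (by omega) →
        ∃ Φ : Seq.Hom A B, Φ.φ ⟨0, by omega⟩ = φ₀ ∧ Φ.φ ⟨1, by omega⟩ = φ₁
  /-- (F4): in the situation of (F3), the extension can be chosen with mapping cone an angle. -/
  complete_cone : ∀ A B, IsAngle A → IsAngle B →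
    ∀ (φ₀ : A.X ⟨0, by omega⟩ ⟶ B.X ⟨0, by omega⟩) (φ₁ : A.X ⟨1, by omega⟩ ⟶ B.X ⟨1, by omega⟩),
      A.f 0 (by omega) ≫ φ₁ = φ₀ ≫ B.f 0 (by omega) →
        ∃ Φ : Seq.Hom A B, (Φ.φ ⟨0, by omega⟩ = φ₀ ∧ Φ.φ ⟨1, by omega⟩ = φ₁) ∧
          ∃ E, Seq.IsCone Φ E ∧ IsAngle E

end Sequences

/-! ### Linear categories: finiteness, the Calabi-Yau condition, additive closures -/

section LinearCategories

/-- A `k`-linear category is Hom-finite if all its Hom-spaces are finite dimensional. -/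
class HomFinite (k : Type w) [Field k] (C : Type u) [Category.{v} C] [Preadditive C]
    [Linear k C] : Prop where
  finite_hom : ∀ X Y : C, Module.Finite k (X ⟶ Y)

/-- For `S` the `d`-suspension `Σ^d`, this is the `2d`-Calabi-Yau condition: isomorphisms
`C(X, Y) ≅ D C(Y, Σ^{2d} X)` that are natural in `X` and `Y`, where `Σ^{2d} = S ∘ S`. -/
def IsTwiceCalabiYau (k : Type w) [Field k] {C : Type u} [Category.{v} C] [Preadditive C]
    [Linear k C] (S : C ⥤ C) : Prop :=
  ∃ e : ∀ X Y : C, (X ⟶ Y) ≃ₗ[k] Module.Dual k (Y ⟶ S.obj (S.obj X)),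
    ∀ {X X' Y Y' : C} (a : X' ⟶ X) (b : Y ⟶ Y') (h : X ⟶ Y) (g : Y' ⟶ S.obj (S.obj X')),
      e X' Y' (a ≫ h ≫ b) g = e X Y h (b ≫ g ≫ S.map (S.map a))

variable {C : Type u} [Category.{v} C] [Preadditive C] [HasFiniteBiproducts C]

instance hasBinaryBiproducts_of_finite : HasBinaryBiproducts C :=
  hasBinaryBiproducts_of_finite_biproducts C

/-- `Z` is a direct summand of `X`. -/
def IsSummand (Z X : C) : Prop := ∃ W : C, Nonempty (X ≅ Z ⊞ W)

/-- `Z` lies in `add T`: it is a direct summand of a finite direct sum of copies of `T`. -/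
def InAdd (T Z : C) : Prop := ∃ n : ℕ, IsSummand Z (⨁ fun _ : Fin n => T)

/-- `Ext^d(X, Y) = C(X, Σ^d Y)`, where `S` is the `d`-suspension `Σ^d`. -/
abbrev ExtD (S : C ⥤ C) (X Y : C) : Type v := X ⟶ S.obj Y

/-- `T` is Oppermann-Thomas cluster tilting: it is `d`-rigid, and each object `Y` admits a
`(d+2)`-angle `T_d ⟶ ⋯ ⟶ T_0 ⟶ Y ⟶ Σ^d T_d` with all `T_i` in `add T`. -/
def IsClusterTilting {S : C ⥤ C} {d : ℕ} (𝒜 : Angulation S d) (T : C) : Prop :=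
  Subsingleton (ExtD S T T) ∧
  ∀ Y : C, ∃ A : Seq S d, 𝒜.IsAngle A ∧
    (∀ (i : ℕ) (h : i < d + 1), InAdd T (A.X ⟨i, by omega⟩)) ∧
    Nonempty (A.X ⟨d + 1, by omega⟩ ≅ Y)

/-- A decomposition `X ≅ X' ⊞ X''` where `X'` (`main`) has no non-zero direct summands in
`add Σ^d T` and `X''` (`rest`) lies in `add Σ^d T`. -/
structure Decomposition (S : C ⥤ C) (T X : C) where
  main : C
  rest : C
  iso : X ≅ main ⊞ rest
  isZero_of_isSummand : ∀ Z : C, IsSummand Z main → InAdd (S.obj T) Z → IsZero Z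
  rest_inAdd : InAdd (S.obj T) rest

end LinearCategories

/-! ### Projective covers, syzygies, the Nakayama functor and `τ_d` -/

section Modules

/-- `p : P ⟶ M` is a projective cover: `P` is projective and `p` is surjective with superfluous
kernel. -/
structure IsProjectiveCover {R : Type v} [Ring R] {P M : Type v} [AddCommGroup P] [Module R P]
    [AddCommGroup M] [Module R M] (p : P →ₗ[R] M) : Prop where
  projective : Module.Projective R P
  surjective : Function.Surjective p
  superfluous : ∀ L : Submodule R P, L ⊔ LinearMap.ker p = ⊤ → L = ⊤

/-- Finitely generated modules over an artinian ring have projective covers. -/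
theorem exists_projectiveCover {R : Type v} [Ring R] [IsArtinianRing R]
    (M : FGModuleCat.{v} R) :
    ∃ (P : FGModuleCat.{v} R) (p : P →ₗ[R] M), IsProjectiveCover p := by
  classical
  let s : Set ℕ∞ := {l | ∃ (P : FGModuleCat.{v} R) (p : P →ₗ[R] M),
    Module.Projective R P ∧ Function.Surjective p ∧ Module.length R P = l}
  have hs : s.Nonempty := by
    obtain ⟨n, p, hp⟩ := Module.Finite.exists_fin' R M
    exact ⟨_, FGModuleCat.of R (Fin n → R), p, inferInstanceAs (Module.Projective R (Fin n → R)),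
      hp, rfl⟩
  obtain ⟨l, ⟨P, p, hP, hp, hl⟩, hmin⟩ := WellFounded.has_min (wellFounded_lt (α := ℕ∞)) s hs
  refine ⟨P, p, hP, hp, fun L hL => ?_⟩
  by_contra hne
  have hsurj : Function.Surjective (p ∘ₗ L.subtype) := by
    intro m
    obtain ⟨x, rfl⟩ := hp m
    have hx : x ∈ L ⊔ LinearMap.ker p := hL ▸ Submodule.mem_top
    obtain ⟨y, hy, z, hz, rfl⟩ := Submodule.mem_sup.1 hx
    refine ⟨⟨y, hy⟩, ?_⟩
    simp [LinearMap.mem_ker.1 hz]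
  obtain ⟨g, hg⟩ := Module.projective_lifting_property (p ∘ₗ L.subtype) p hsurj
  let e : Module.End R P := L.subtype ∘ₗ g
  have he : ∀ x, p (e x) = p x := fun x => LinearMap.congr_fun hg x
  have hen : ∀ (n : ℕ) x, p ((e ^ n) x) = p x := by
    intro n
    induction n with
    | zero => intro x; simp
    | succ n ih => intro x; rw [pow_succ', Module.End.mul_apply, he, ih]
  obtain ⟨n, hn, hn0⟩ := ((LinearMap.eventually_isCompl_ker_pow_range_pow e).and
    (Filter.eventually_ge_atTop 1)).exists
  let Q : Submodule R P := LinearMap.range (e ^ n)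
  have hQL : Q ≤ L := by
    rintro _ ⟨x, rfl⟩
    obtain ⟨m, rfl⟩ : ∃ m, n = m + 1 := ⟨n - 1, by omega⟩
    rw [pow_succ', Module.End.mul_apply]
    exact (g _).2
  have hQ : Module.Projective R Q :=
    Module.Projective.of_split Q.subtype (Q.projectionOnto _ hn.symm) (by
      ext x; simp)
  have hlt : Module.length R Q < Module.length R P :=
    Submodule.length_lt (lt_of_le_of_lt hQL (lt_top_iff_ne_top.2 hne)).ne
  refine hmin (Module.length R Q) ⟨FGModuleCat.of R Q, p ∘ₗ Q.subtype, hQ, ?_, rfl⟩ (hl ▸ hlt)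
  intro m
  obtain ⟨x, rfl⟩ := hp m
  exact ⟨⟨(e ^ n) x, x, rfl⟩, hen n x⟩

variable {R : Type v} [Ring R] [IsArtinianRing R]

/-- The projective cover of a finitely generated module. -/
def projectiveCover (M : FGModuleCat.{v} R) : FGModuleCat.{v} R :=
  (exists_projectiveCover M).choose

/-- The map from the projective cover of `M` to `M`. -/
def projectiveCoverMap (M : FGModuleCat.{v} R) : projectiveCover M →ₗ[R] M :=
  (exists_projectiveCover M).choose_spec.choose

theorem isProjectiveCover_projectiveCoverMap (M : FGModuleCat.{v} R) :
    IsProjectiveCover (projectiveCoverMap M) :=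
  (exists_projectiveCover M).choose_spec.choose_spec

/-- The (minimal) syzygy `Ω M`: the kernel of the projective cover of `M`. -/
def syzygy (M : FGModuleCat.{v} R) : FGModuleCat.{v} R :=
  FGModuleCat.of R (LinearMap.ker (projectiveCoverMap M))

/-- The differential `P₁ ⟶ P₀` of the minimal projective presentation `P₁ ⟶ P₀ ⟶ M ⟶ 0`:
`P₀` is the projective cover of `M` and `P₁` is the projective cover of `Ω M ⊆ P₀`. -/
def presentationMap (M : FGModuleCat.{v} R) :
    projectiveCover (syzygy M) →ₗ[R] projectiveCover M :=
  (LinearMap.ker (projectiveCoverMap M)).subtype ∘ₗ projectiveCoverMap (syzygy M)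

end Modules

section Nakayama

variable (k R : Type v) [Field k] [Ring R] [Algebra k R]

/-- The value `ν P = D Hom_R(P, R)` of the Nakayama functor. -/
def Nakayama (P : Type v) [AddCommGroup P] [Module R P] : Type v :=
  Module.Dual k (P →ₗ[R] R)

namespace Nakayama

variable (P : Type v) [AddCommGroup P] [Module R P]

instance : AddCommGroup (Nakayama k R P) :=
  inferInstanceAs (AddCommGroup (Module.Dual k (P →ₗ[R] R)))

instance : Module k (Nakayama k R P) :=
  inferInstanceAs (Module k (Module.Dual k (P →ₗ[R] R)))

/-- Right multiplication `g ↦ (x ↦ g x * r)` on `Hom_R(P, R)`. -/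
def mulRight (r : R) : (P →ₗ[R] R) →ₗ[k] (P →ₗ[R] R) where
  toFun g :=
    { toFun := fun x => g x * r
      map_add' := fun x y => by simp [add_mul]
      map_smul' := fun a x => by simp [mul_assoc] }
  map_add' g h := by ext x; simp [add_mul]
  map_smul' c g := by ext x; simp

/-- The `R`-module structure on `ν P`: `(r • φ) g = φ (g r)`. -/
instance : Module R (Nakayama k R P) where
  smul r φ := LinearMap.comp (M₃ := k) φ (mulRight k R P r)
  one_smul (φ : Module.Dual k (P →ₗ[R] R)) := LinearMap.ext fun g =>
    congrArg φ (by ext x; simp [mulRight])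
  mul_smul r s (φ : Module.Dual k (P →ₗ[R] R)) := LinearMap.ext fun g =>
    congrArg φ (by ext x; simp [mulRight, mul_assoc])
  smul_zero r := LinearMap.ext fun g => rfl
  smul_add r φ ψ := LinearMap.ext fun g => rfl
  add_smul r s (φ : Module.Dual k (P →ₗ[R] R)) := LinearMap.ext fun g =>
    (congrArg φ (by
      ext x; simp [mulRight, mul_add] :
        mulRight k R P (r + s) g = mulRight k R P r g + mulRight k R P s g)).trans
      (map_add φ (mulRight k R P r g) (mulRight k R P s g))
  zero_smul (φ : Module.Dual k (P →ₗ[R] R)) := LinearMap.ext fun g =>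
    (congrArg φ (by ext x; simp [mulRight] : mulRight k R P 0 g = 0)).trans (map_zero φ)

instance : IsScalarTower k R (Nakayama k R P) where
  smul_assoc c r (φ : Module.Dual k (P →ₗ[R] R)) := LinearMap.ext fun g =>
    (congrArg φ (by
      ext x; simp [mulRight] : mulRight k R P (c • r) g = c • mulRight k R P r g)).trans (map_smul φ c (mulRight k R P r g))

variable {P} in
/-- The map `ν P ⟶ ν Q` induced by `f : P ⟶ Q`. -/
def map {Q : Type v} [AddCommGroup Q] [Module R Q] (f : P →ₗ[R] Q) :
    Nakayama k R P →ₗ[R] Nakayama k R Q where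
  toFun φ := LinearMap.comp (M₃ := k) φ
    ({ toFun := fun g => g ∘ₗ f
       map_add' := fun _ _ => rfl
       map_smul' := fun _ _ => rfl } : (Q →ₗ[R] R) →ₗ[k] (P →ₗ[R] R))
  map_add' _ _ := rfl
  map_smul' r (φ : Module.Dual k (P →ₗ[R] R)) := LinearMap.ext fun g =>
    congrArg φ (by ext x; rfl : mulRight k R P r (g ∘ₗ f) = (mulRight k R Q r g) ∘ₗ f)

theorem finite [Module.Finite k R] [Module.Finite R P] : Module.Finite R (Nakayama k R P) := by
  obtain ⟨n, p, hp⟩ := Module.Finite.exists_fin' R P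
  let ev : (P →ₗ[R] R) →ₗ[k] (Fin n → R) :=
    { toFun := fun g i => g (p (Pi.single i 1))
      map_add' := fun _ _ => rfl
      map_smul' := fun _ _ => rfl }
  have hev : Function.Injective ev := by
    intro g h hgh
    have : g ∘ₗ p = h ∘ₗ p := by
      refine LinearMap.pi_ext' fun i => LinearMap.ext_ring ?_
      exact congrFun hgh i
    ext x
    obtain ⟨y, rfl⟩ := hp x
    exact LinearMap.congr_fun this y
  have h1 : Module.Finite k (P →ₗ[R] R) := Module.Finite.of_injective ev hev
  have h2 : Module.Finite k (Nakayama k R P) :=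
    inferInstanceAs (Module.Finite k (Module.Dual k (P →ₗ[R] R)))
  exact Module.Finite.of_restrictScalars_finite k R _

end Nakayama

theorem isArtinianRing_of_finite [Module.Finite k R] : IsArtinianRing R :=
  IsArtinianRing.of_finite k R

variable {R} [Module.Finite k R]

/-- The Auslander-Reiten translation `τ M = D Tr M` of a finitely generated module over a
finite-dimensional algebra: the kernel of `ν P₁ ⟶ ν P₀`, where `P₁ ⟶ P₀ ⟶ M ⟶ 0` is the minimal
projective presentation. -/
def tau (M : FGModuleCat.{v} R) : FGModuleCat.{v} R :=
  haveI := isArtinianRing_of_finite k R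
  haveI := Nakayama.finite k R (projectiveCover (syzygy M))
  FGModuleCat.of R (LinearMap.ker (Nakayama.map k R (presentationMap M)))

/-- The `d`-Auslander-Reiten translation `τ_d = τ Ω^{d-1}`, for `1 ≤ d`. -/
def tauD (d : ℕ) (M : FGModuleCat.{v} R) : FGModuleCat.{v} R :=
  haveI := isArtinianRing_of_finite k R
  tau k (syzygy^[d - 1] M)

end Nakayama

/-! ### The functor `C(T, -)` and the pairs `Δ(X)` -/

section HomModules

variable (k : Type w) [Field k] {C : Type u} [Category.{v} C] [Preadditive C] [Linear k C]
  [HomFinite k C] (T : C)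

instance finite_end_op : Module.Finite k (End T)ᵐᵒᵖ :=
  haveI : Module.Finite k (End T) := HomFinite.finite_hom T T
  Module.Finite.equiv (MulOpposite.opLinearEquiv k)

/-- The module `C(T, X)`, an object of `mod Γ`. Multiplication in `Γ = End T` is composition of
functions, so that `Γ` acts on `C(T, X)` from the right, which means that `C(T, X)` is a (left)
module over the opposite ring of `Γ`. -/
def homModule (X : C) : FGModuleCat.{v} (End T)ᵐᵒᵖ :=
  ⟨(preadditiveCoyonedaObj T).obj X, by
    have : Module.Finite k (T ⟶ X) := HomFinite.finite_hom T X
    have : IsScalarTower k (End T)ᵐᵒᵖ (T ⟶ X) :=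
      ⟨fun c r x => Linear.smul_comp _ _ _ c r.unop x⟩
    exact Module.Finite.of_restrictScalars_finite k (End T)ᵐᵒᵖ (T ⟶ X)⟩

variable [HasFiniteBiproducts C] {T}

/-- The first component `M = C(T, X')` of `Δ(X) = (M, P)`. -/
def Decomposition.M {S : C ⥤ C} {X : C} (D : Decomposition S T X) :
    FGModuleCat.{v} (End T)ᵐᵒᵖ :=
  homModule k T D.main

/-- The second component `P = C(T, Σ^{-d} X'')` of `Δ(X) = (M, P)`. -/
def Decomposition.P {S : C ≌ C} {X : C} (D : Decomposition S.functor T X) :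
    FGModuleCat.{v} (End T)ᵐᵒᵖ :=
  homModule k T (S.inverse.obj D.rest)

end HomModules

end HigherAngulated

end

open HigherAngulated

/-! Write `S` for `Σ^d`, and suppose first that `X` and `Y` have no non-zero summands in `add S T`.
Applying `C(T, -)` to an angle `T_d ⟶ ⋯ ⟶ T_0 ⟶ Y ⟶ S T_d` gives a projective resolution of `N =
C(T, Y)`: angles are Hom-exact, and rigidity of `T` makes the last map onto. A summand of `T_d`
killed by the first map would have its suspension as a summand of `Y`, so the resolution is minimal
at its left end, which is all that `τ_d` requires. Since `Hom(A, ν P) ≅ D Hom(P, A)`, the dimension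
of `Hom(M, τ_d N)` is that of the cokernel of `C(T_{d-1}, X) ⟶ C(T_d, X)`. By exactness this is the
dimension of the space of morphisms `Y ⟶ S X` that factor through `δ : Y ⟶ S T_d`
(`exists_tiltingResolution`).

By the Calabi–Yau duality, `Hom(N, τ_d M)` has the dimension of the image of `C(Y, S X)` under
composition with `S δ_X`. Rigidity shows that the kernel of this composition consists exactly of the
morphisms factoring through `δ_Y`, so rank–nullity adds the two terms up to `dim C(Y, S X) = dim
C(X, S Y)` (`TiltingResolution.finrank_add`).

In general both objects are split. The block with both parts in `add S T` vanishes, and the mixed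
blocks give `Hom(P, N)` and `Hom(Q, M)`, because `C(T, -)` is fully faithful on morphisms out of
`add T` (`finrank_extD`). -/

noncomputable section

namespace HigherAngulated

/-! ### Comparing projective presentations with projective covers. -/

section StableKernels

variable {R : Type v} [Ring R]

/-- A surjection from a projective module onto `M ≅ M' × R'`, with `R'` projective, is the projective
cover of `M'` plus `R'` plus a split submodule `K` of its kernel. -/
theorem IsProjectiveCover.exists_split {M M' R' P Q : Type v}
    [AddCommGroup M] [Module R M] [AddCommGroup M'] [Module R M'] [AddCommGroup R'] [Module R R']
    [AddCommGroup P] [Module R P] [AddCommGroup Q] [Module R Q]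
    [Module.Projective R P] [Module.Projective R R']
    {p : P →ₗ[R] M} (hp : Function.Surjective p) {q : Q →ₗ[R] M'} (hq : IsProjectiveCover q)
    (e : M ≃ₗ[R] M' × R') :
    ∃ (K : Submodule R P) (r : P →ₗ[R] K), K ≤ LinearMap.ker p ∧ r ∘ₗ K.subtype = LinearMap.id ∧
      Nonempty (P ≃ₗ[R] (Q × R') × K) ∧
      Nonempty (LinearMap.ker p ≃ₗ[R] LinearMap.ker q × K) := by
  have := hq.projective
  let q' : Q × R' →ₗ[R] M := e.symm ∘ₗ LinearMap.prodMap q LinearMap.id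
  have hq' : Function.Surjective q' :=
    e.symm.surjective.comp (Function.Surjective.prodMap hq.surjective Function.surjective_id)
  obtain ⟨α, hα⟩ := Module.projective_lifting_property q' p hq'
  have hα' : ∀ x, (q (α x).1, (α x).2) = e (p x) := fun x => by
    rw [← hα]; simp [q']
  have hdiff : ∀ z : Q × R', ∃ x, ∃ y ∈ LinearMap.ker q, z = α x + (y, 0) := by
    intro z
    obtain ⟨x, hx⟩ := hp (q' z)
    have h1 := hα' x
    rw [hx] at h1
    simp only [q', LinearMap.comp_apply, LinearEquiv.coe_coe, LinearEquiv.apply_symm_apply,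
      LinearMap.prodMap_apply, LinearMap.id_apply, Prod.mk.injEq] at h1
    exact ⟨x, z.1 - (α x).1, by simp [h1.1], by ext <;> simp [h1.2]⟩
  -- Superfluousness is known only inside `Q`, so the range of `α` is pulled back to `Q`. Then `α`
  -- is onto, hence split, and `K` is its kernel.
  have hL : (LinearMap.range α).comap (LinearMap.inl R Q R') = ⊤ := by
    apply hq.superfluous
    rw [eq_top_iff]
    intro x _
    obtain ⟨a, y, hy, h⟩ := hdiff (x, 0)
    refine Submodule.mem_sup.2 ⟨x - y, ⟨a, ?_⟩, y, hy, by simp⟩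
    rw [eq_sub_of_add_eq h.symm]
    simp
  have hsurj : Function.Surjective α := by
    intro z
    obtain ⟨x, y, -, h⟩ := hdiff z
    have hy : y ∈ (LinearMap.range α).comap (LinearMap.inl R Q R') := hL ▸ Submodule.mem_top
    obtain ⟨x', hx'⟩ := hy
    exact ⟨x + x', by rw [map_add, hx', h]; rfl⟩
  obtain ⟨s, hs⟩ := Module.projective_lifting_property α LinearMap.id hsurj
  have hs' : ∀ z, α (s z) = z := LinearMap.congr_fun hs
  have hps : ∀ z, p (s z) = q' z := fun z => by rw [← hα, LinearMap.comp_apply, hs']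
  let r : P →ₗ[R] LinearMap.ker α :=
    LinearMap.codRestrict _ (LinearMap.id - s ∘ₗ α) (fun x => by simp [hs'])
  have hr : ∀ x, (r x : P) = x - s (α x) := fun x => rfl
  have hker : LinearMap.ker α ≤ LinearMap.ker p := by
    intro x hx
    rw [LinearMap.mem_ker] at hx ⊢
    rw [← hα, LinearMap.comp_apply, hx, map_zero]
  refine ⟨LinearMap.ker α, r, hker, ?_, ⟨?_⟩, ⟨?_⟩⟩
  · ext x
    simp [hr, LinearMap.mem_ker.1 x.2]
  · refine LinearEquiv.ofLinearMap (α.prod r) (s.coprod (Submodule.subtype _)) ?_ ?_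
    · refine LinearMap.ext fun z => Prod.ext ?_ (Subtype.ext ?_)
      · simp [hs', LinearMap.mem_ker.1 z.2.2]
      · simp [hs', hr, LinearMap.mem_ker.1 z.2.2]
    · ext x; simp [hr]
  · have h1 : ∀ x : LinearMap.ker p, q (α x).1 = 0 ∧ (α x).2 = 0 := fun x => by
      have := hα' x
      rwa [LinearMap.mem_ker.1 x.2, map_zero, Prod.ext_iff] at this
    let a : LinearMap.ker p →ₗ[R] LinearMap.ker q := LinearMap.codRestrict _
      (LinearMap.fst R Q R' ∘ₗ α ∘ₗ Submodule.subtype _) (fun x => (h1 x).1)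
    let b : LinearMap.ker q × LinearMap.ker α →ₗ[R] LinearMap.ker p :=
      LinearMap.codRestrict _ ((s ∘ₗ LinearMap.inl R Q R' ∘ₗ Submodule.subtype _).coprod
        (Submodule.subtype _)) (fun z => by
          have := LinearMap.mem_ker.1 (hker z.2.2)
          simp [this, hps, q', LinearMap.mem_ker.1 z.1.2])
    have ha : ∀ x, (a x : Q) = (α x).1 := fun x => rfl
    have hb : ∀ z, (b z : P) = s (z.1, 0) + z.2 := fun z => rfl
    have hαb : ∀ z, α (b z) = (z.1.1, 0) := fun z => by
      rw [hb, map_add, hs', LinearMap.mem_ker.1 z.2.2, add_zero]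
    refine LinearEquiv.ofLinearMap (LinearMap.prod a (r ∘ₗ Submodule.subtype _)) b ?_ ?_
    · refine LinearMap.ext fun z => Prod.ext (Subtype.ext ?_) (Subtype.ext ?_)
      · simp [ha, hαb]
      · change (r (b z) : P) = z.2; rw [hr, hαb, hb, add_sub_cancel_left]
    · refine LinearMap.ext fun x => Subtype.ext ?_
      have : ((α x).1, (0 : R')) = α x := Prod.ext rfl (h1 x).2.symm
      simp [hr, hb, ha, this]

end StableKernels

/-! ### The duality `D Hom(P, A) ≅ Hom(A, ν P)` and dimension counts. -/

section NakayamaDuality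

variable (k : Type v) {R : Type v} [Field k] [Ring R] [Algebra k R]
variable {P Q : Type v} [AddCommGroup P] [Module R P] [AddCommGroup Q] [Module R Q]
variable (A : Type v) [AddCommGroup A] [Module R A] [Module k A] [IsScalarTower k R A]

/-- The natural map `D Hom(P, A) ⟶ Hom(A, ν P)`. -/
def toHomNakayama : Module.Dual k (P →ₗ[R] A) →ₗ[k] (A →ₗ[R] Nakayama k R P) where
  toFun φ :=
    { toFun := fun a => LinearMap.comp (M₃ := k) φ
        ({ toFun := fun g => LinearMap.toSpanSingleton R A a ∘ₗ g
           map_add' := fun g h => by ext x; simp [add_smul]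
           map_smul' := fun c g => by ext x; simp } : (P →ₗ[R] R) →ₗ[k] (P →ₗ[R] A))
      map_add' := fun a b => LinearMap.ext (M₃ := k) fun g => by
        refine (congrArg φ ?_).trans (map_add φ _ _)
        ext x; simp
      map_smul' := fun r a => LinearMap.ext (M₃ := k) fun g => congrArg φ (by
        ext x; simp [Nakayama.mulRight, mul_smul]) }
  map_add' _ _ := rfl
  map_smul' _ _ := rfl

theorem toHomNakayama_apply (φ : Module.Dual k (P →ₗ[R] A)) (a : A) (g : P →ₗ[R] R) :
    (show Module.Dual k (P →ₗ[R] R) from toHomNakayama k (R := R) A φ a) g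
      = φ (LinearMap.toSpanSingleton R A a ∘ₗ g) := rfl

/-- A dual basis `(x i, f i)` of `P` provides the inverse: `ψ` goes to the functional `h ↦ ∑ i, ψ (h
(x i)) (f i)`. -/
theorem toHomNakayama_bijective [Module.Projective R P] [Module.Finite R P] :
    Function.Bijective (toHomNakayama k (R := R) (P := P) A) := by
  obtain ⟨n, p, hp⟩ := Module.Finite.exists_fin' R P
  obtain ⟨s, hs⟩ := Module.projective_lifting_property p LinearMap.id hp
  let f : Fin n → P →ₗ[R] R := fun i => LinearMap.proj i ∘ₗ s
  let x : Fin n → P := fun i => p (Pi.single i 1)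
  have hx : ∀ y, ∑ i, f i y • x i = y := fun y => by
    have h2 : p (s y) = y := LinearMap.congr_fun hs y
    conv_rhs => rw [← h2, pi_eq_sum_univ' (s y), map_sum]
    refine Finset.sum_congr rfl fun i _ => ?_
    rw [← map_smul]
    rfl
  constructor
  · rw [← LinearMap.ker_eq_bot, LinearMap.ker_eq_bot']
    intro φ hφ
    refine LinearMap.ext fun h => ?_
    have : h = ∑ i, LinearMap.toSpanSingleton R A (h (x i)) ∘ₗ f i := by
      ext y
      conv_lhs => rw [← hx y, map_sum]
      simp
    rw [this, map_sum]
    refine Finset.sum_eq_zero fun i _ => ?_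
    rw [← toHomNakayama_apply (R := R) k A φ, hφ]
    rfl
  · intro ψ
    let ψ' : A → Module.Dual k (P →ₗ[R] R) := ψ
    have hψk : ∀ (c : k) a, ψ' (c • a) = c • ψ' a := fun c a => LinearMap.map_smul_of_tower ψ c a
    refine ⟨
      { toFun := fun h => ∑ i, ψ' (h (x i)) (f i)
        map_add' := fun g h => ?_
        map_smul' := fun c h => ?_ }, ?_⟩
    · rw [← Finset.sum_add_distrib]
      exact Finset.sum_congr rfl fun i _ => LinearMap.congr_fun (map_add ψ _ _ : ψ' _ = _) (f i)
    · simp [hψk, Finset.mul_sum]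
    · refine LinearMap.ext fun a => LinearMap.ext (M₃ := k) fun g => ?_
      change ∑ i, ψ' (g (x i) • a) (f i) = ψ' a g
      have h3 : ∀ i, ψ' (g (x i) • a) (f i) = ψ' a (Nakayama.mulRight k R P (g (x i)) (f i)) :=
        fun i => LinearMap.congr_fun (map_smul ψ (g (x i)) a : ψ' _ = _) (f i)
      simp_rw [h3, ← map_sum]
      congr 1
      ext y
      conv_rhs => rw [← hx y, map_sum]
      simp [Nakayama.mulRight]

theorem map_comp_toHomNakayama (f : P →ₗ[R] Q) (φ : Module.Dual k (P →ₗ[R] A)) :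
    Nakayama.map k R f ∘ₗ toHomNakayama k A φ
      = toHomNakayama k A ((LinearMap.lcomp k A f).dualMap φ) := rfl

variable [Module.Finite k A]

theorem finite_linearMap [Module.Finite R P] : Module.Finite k (P →ₗ[R] A) := by
  obtain ⟨n, p, hp⟩ := Module.Finite.exists_fin' R P
  let ev : (P →ₗ[R] A) →ₗ[k] (Fin n → A) :=
    { toFun := fun g i => g (p (Pi.single i 1))
      map_add' := fun _ _ => rfl
      map_smul' := fun _ _ => rfl }
  refine Module.Finite.of_injective ev fun g h hgh => ?_
  have : g ∘ₗ p = h ∘ₗ p := LinearMap.pi_ext' fun i => LinearMap.ext_ring (congrFun hgh i)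
  ext x
  obtain ⟨y, rfl⟩ := hp x
  exact LinearMap.congr_fun this y

/-- `dim Hom(A, ker(ν P ⟶ ν Q))` is the dimension of the cokernel of `Hom(Q, A) ⟶ Hom(P, A)`. -/
theorem finrank_hom_ker_nakayama [Module.Projective R P] [Module.Finite R P]
    [Module.Projective R Q] [Module.Finite R Q] (f : P →ₗ[R] Q) :
    Module.finrank k (A →ₗ[R] LinearMap.ker (Nakayama.map k R f))
      + Module.finrank k (LinearMap.range (LinearMap.lcomp k A f))
      = Module.finrank k (P →ₗ[R] A) := by
  have := finite_linearMap k (R := R) (P := P) A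
  have := finite_linearMap k (R := R) (P := Q) A
  have e : (A →ₗ[R] LinearMap.ker (Nakayama.map k R f)) ≃ₗ[k]
      LinearMap.ker (LinearMap.lcomp k A f).dualMap := by
    let E := LinearEquiv.ofBijective _ (toHomNakayama_bijective k (R := R) (P := P) A)
    -- Naturality of the duality in `P`, together with its injectivity at `Q`.
    have key : ∀ φ, φ ∈ LinearMap.ker (LinearMap.lcomp k A f).dualMap ↔
        ∀ a, toHomNakayama k A φ a ∈ LinearMap.ker (Nakayama.map k R f) := by
      intro φ
      rw [LinearMap.mem_ker, ← map_eq_zero_iff _ (toHomNakayama_bijective k (R := R) (P := Q) A).1,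
        ← map_comp_toHomNakayama, LinearMap.ext_iff]
      rfl
    refine LinearEquiv.symm (LinearEquiv.ofBijective
      { toFun := fun φ => LinearMap.codRestrict _ (toHomNakayama k A φ.1) ((key φ.1).1 φ.2)
        map_add' := fun _ _ => rfl
        map_smul' := fun _ _ => rfl } ⟨?_, ?_⟩)
    · intro φ ψ h
      refine Subtype.ext (E.injective (LinearMap.ext fun a => ?_))
      exact congrArg Subtype.val (LinearMap.congr_fun h a)
    · intro ψ
      obtain ⟨φ, hφ⟩ := E.surjective (Submodule.subtype _ ∘ₗ ψ)
      have hφ' : ∀ a, toHomNakayama k A φ a = (ψ a).1 := LinearMap.congr_fun hφ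
      refine ⟨⟨φ, (key φ).2 fun a => ?_⟩, LinearMap.ext fun a => Subtype.ext (hφ' a)⟩
      rw [hφ']
      exact (ψ a).2
  rw [e.finrank_eq, ← LinearMap.finrank_range_dualMap_eq_finrank_range, add_comm,
    LinearMap.finrank_range_add_finrank_ker, Subspace.dual_finrank_eq]

/-- For an exact sequence `P ⟶ Q ⟶ L ⟶ 0`, the rank of `Hom(Q, A) ⟶ Hom(P, A)`. -/
theorem finrank_range_lcomp [Module.Finite R Q] {L : Type v} [AddCommGroup L] [Module R L]
    (f : P →ₗ[R] Q) (g : Q →ₗ[R] L) (hg : Function.Surjective g)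
    (hfg : LinearMap.range f = LinearMap.ker g) :
    Module.finrank k (LinearMap.range (LinearMap.lcomp k A f)) + Module.finrank k (L →ₗ[R] A)
      = Module.finrank k (Q →ₗ[R] A) := by
  have := finite_linearMap k (R := R) (P := Q) A
  have e : (L →ₗ[R] A) ≃ₗ[k] LinearMap.ker (LinearMap.lcomp k A f) := by
    refine LinearEquiv.ofBijective (LinearMap.codRestrict _ (LinearMap.lcomp k A g) fun h => ?_)
      ⟨?_, ?_⟩
    · refine LinearMap.ext fun x => ?_
      have : f x ∈ LinearMap.ker g := hfg ▸ LinearMap.mem_range_self f x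
      simp [LinearMap.mem_ker.1 this]
    · intro h h' hh
      refine LinearMap.ext fun y => ?_
      obtain ⟨x, rfl⟩ := hg y
      exact LinearMap.congr_fun (congrArg Subtype.val hh) x
    · rintro ⟨h, hh⟩
      have hle : LinearMap.ker g ≤ LinearMap.ker h := by
        rw [← hfg]
        rintro _ ⟨x, rfl⟩
        exact LinearMap.congr_fun (LinearMap.mem_ker.1 hh) x
      refine ⟨(LinearMap.ker g).liftQ h hle ∘ₗ (g.quotKerEquivOfSurjective hg).symm,
        Subtype.ext (LinearMap.ext fun x => ?_)⟩
      change (LinearMap.ker g).liftQ h hle ((g.quotKerEquivOfSurjective hg).symm (g x)) = h x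
      have : (g.quotKerEquivOfSurjective hg).symm (g x) = Submodule.Quotient.mk x := by
        rw [LinearEquiv.symm_apply_eq]; rfl
      simp [this]
  rw [e.finrank_eq, LinearMap.finrank_range_add_finrank_ker]

theorem finrank_hom_prod [Module.Finite R P] [Module.Finite R Q] :
    Module.finrank k (P × Q →ₗ[R] A)
      = Module.finrank k (P →ₗ[R] A) + Module.finrank k (Q →ₗ[R] A) := by
  have := finite_linearMap k (R := R) (P := P) A
  have := finite_linearMap k (R := R) (P := Q) A
  rw [← (LinearMap.coprodEquiv (R := R) (M := P) (M₂ := Q) (M₃ := A) k).finrank_eq,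
    Module.finrank_prod]

omit [Module.Finite k A] in
theorem finrank_hom_congr (e : P ≃ₗ[R] Q) :
    Module.finrank k (P →ₗ[R] A) = Module.finrank k (Q →ₗ[R] A) :=
  LinearEquiv.finrank_eq
    { toFun := fun f => f ∘ₗ e.symm
      map_add' := fun _ _ => rfl
      map_smul' := fun _ _ => rfl
      invFun := fun f => f ∘ₗ e
      left_inv := fun f => by ext; simp
      right_inv := fun f => by ext; simp }

end NakayamaDuality

/-! ### Computing `τ` and `τ_d` from resolutions minimal only at the left end. -/

section Tau

variable (k : Type v) {R : Type v} [Field k] [Ring R] [Algebra k R]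

/-- Morphisms of finitely generated modules are linear maps. -/
def homLinearEquiv (M N : FGModuleCat.{v} R) [Module k N] [IsScalarTower k R N] :
    (M ⟶ N) ≃ₗ[k] (M →ₗ[R] N) where
  toFun f := f.hom.hom
  map_add' _ _ := rfl
  map_smul' c f := LinearMap.ext fun x => algebraMap_smul R c (f.hom.hom x)
  invFun f := ⟨ModuleCat.ofHom f⟩
  left_inv _ := rfl
  right_inv _ := rfl

variable [Module.Finite k R]

/-- The first term of a projective presentation `P ⟶ Q ⟶ L ⟶ 0` of `L ≅ M × R'`, with `R'`
projective, in which `P` has no summand in the kernel, computes `Hom(A, τ M)`. -/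
theorem finrank_hom_tau (M : FGModuleCat.{v} R) {P Q L R' : Type v}
    [AddCommGroup P] [Module R P] [AddCommGroup Q] [Module R Q] [AddCommGroup L] [Module R L]
    [AddCommGroup R'] [Module R R']
    [Module.Projective R P] [Module.Finite R P] [Module.Projective R Q] [Module.Finite R Q]
    [Module.Projective R R'] [Module.Finite R R']
    (f : P →ₗ[R] Q) (g : Q →ₗ[R] L) (hg : Function.Surjective g)
    (hfg : LinearMap.range f = LinearMap.ker g) (e : L ≃ₗ[R] M × R')
    (hf : ∀ ε : P →ₗ[R] P, ε ∘ₗ ε = ε → f ∘ₗ ε = 0 → ε = 0)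
    (A : FGModuleCat.{v} R) [Module k A] [IsScalarTower k R A] :
    Module.finrank k (A ⟶ tau k M) + Module.finrank k (LinearMap.range (LinearMap.lcomp k A f))
      = Module.finrank k (P →ₗ[R] A) := by
  have := isArtinianRing_of_finite k R
  have : Module.Finite k A := Module.Finite.trans R A
  have hM := isProjectiveCover_projectiveCoverMap M
  have hΩ := isProjectiveCover_projectiveCoverMap (syzygy M)
  have := hM.projective
  have := hΩ.projective
  have := Nakayama.finite k R (projectiveCover (syzygy M))
  have h1 : Module.finrank k (A ⟶ tau k M)
      + Module.finrank k (LinearMap.range (LinearMap.lcomp k A (presentationMap M)))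
      = Module.finrank k (projectiveCover (syzygy M) →ₗ[R] A) := by
    rw [← finrank_hom_ker_nakayama k A (presentationMap M)]
    congr 1
    exact (homLinearEquiv k A (FGModuleCat.of R
      (LinearMap.ker (Nakayama.map k R (presentationMap M))))).finrank_eq
  have h2 := finrank_range_lcomp k A (presentationMap M) (projectiveCoverMap M) hM.surjective (by
    refine le_antisymm ?_ fun x hx => ?_
    · rintro _ ⟨x, rfl⟩
      exact (projectiveCoverMap (syzygy M) x).2
    · obtain ⟨y, hy⟩ := hΩ.surjective ⟨x, hx⟩
      exact ⟨y, congrArg Subtype.val hy⟩)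
  have h3 := finrank_range_lcomp k A f g hg hfg
  -- With `P₁ ⟶ P₀` the minimal presentation of `M`, this gives `Q ≅ (P₀ × R') × K` and `ker g ≅ Ω M
  -- × K`. A second splitting, of `P ⟶ ker g`, then gives `P ≅ (P₁ × K) × K'`.
  obtain ⟨K, r, -, hr, ⟨eQ⟩, ⟨eK⟩⟩ := hM.exists_split hg e
  have : Module.Finite R K := Module.Finite.of_surjective r fun x => ⟨x, LinearMap.congr_fun hr x⟩
  have : Module.Projective R K :=
    Module.Projective.of_split K.subtype r hr
  let f' : P →ₗ[R] LinearMap.ker g :=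
    LinearMap.codRestrict _ f fun x => hfg ▸ LinearMap.mem_range_self f x
  have hf' : Function.Surjective f' := by
    rintro ⟨y, hy⟩
    obtain ⟨x, rfl⟩ : y ∈ LinearMap.range f := hfg ▸ hy
    exact ⟨x, rfl⟩
  obtain ⟨K', r', hK', hr', ⟨eP⟩, -⟩ := hΩ.exists_split hf' eK
  have : Module.Finite R K' :=
    Module.Finite.of_surjective r' fun x => ⟨x, LinearMap.congr_fun hr' x⟩
  have hr'' : ∀ x : K', r' x = x := LinearMap.congr_fun hr'
  -- The projection of `P` onto `K'` is an idempotent killed by `f`, so `K'` vanishes.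
  have hε := hf (K'.subtype ∘ₗ r') (by ext x; simp [hr'']) (by
    ext x
    exact congrArg Subtype.val (LinearMap.mem_ker.1 (hK' (r' x).2)))
  have : Subsingleton K' := by
    refine subsingleton_of_forall_eq 0 fun x => Subtype.ext ?_
    have := LinearMap.congr_fun hε x
    simpa [hr''] using this
  have hK0 : Module.finrank k (K' →ₗ[R] A) = 0 := by
    have : Subsingleton (K' →ₗ[R] A) := ⟨fun a b => LinearMap.ext fun x => by
      rw [Subsingleton.elim x 0, map_zero, map_zero]⟩
    exact Module.finrank_zero_of_subsingleton
  have h4 := finrank_hom_congr k (A := A) e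
  have h5 := finrank_hom_congr k (A := A) eQ
  have h6 := finrank_hom_congr k (A := A) eP
  simp only [finrank_hom_prod] at h4 h5 h6
  -- The contributions of `K` and `R'` cancel in `dim Hom(P, A) - dim Hom(Q, A) + dim Hom(L, A)`.
  omega

/-- Non-minimal terms only add projective summands to the syzygies, so the intermediate terms need
not be minimal. The induction runs from the right end of the resolution to the left. -/
theorem exists_range_equiv_iterate_syzygy [IsArtinianRing R] {d : ℕ}
    (V : Fin (d + 2) → FGModuleCat.{v} R)
    (f : ∀ (i : ℕ) (h : i < d + 1), V ⟨i, by omega⟩ →ₗ[R] V ⟨i + 1, by omega⟩)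
    (hV : ∀ (i : ℕ) (h : i < d + 1), Module.Projective R (V ⟨i, by omega⟩))
    (hf : ∀ (i : ℕ) (h : i < d),
      LinearMap.range (f i (by omega)) = LinearMap.ker (f (i + 1) (by omega)))
    (hd : Function.Surjective (f d (by omega)))
    {M : FGModuleCat.{v} R} (e : V ⟨d + 1, by omega⟩ ≃ₗ[R] M) (j : ℕ) :
    ∀ (i : ℕ) (h : i + j = d), ∃ K : FGModuleCat.{v} R, Module.Projective R K ∧
      Nonempty (LinearMap.range (f i (by omega)) ≃ₗ[R]
        (syzygy^[j] M : FGModuleCat.{v} R) × K) := by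
  induction j with
  | zero =>
    rintro i rfl
    refine ⟨FGModuleCat.of R PUnit, inferInstanceAs (Module.Projective R PUnit.{v + 1}), ⟨?_⟩⟩
    exact ((LinearEquiv.ofTop _ (LinearMap.range_eq_top.2 hd)).trans e).trans
      LinearEquiv.prodUnique.symm
  | succ j ih =>
    intro i h
    obtain ⟨K, hK, ⟨e⟩⟩ := ih (i + 1) (by omega)
    have := hV (i + 1) (by omega)
    obtain ⟨K', r, -, hr, -, ⟨e'⟩⟩ := (isProjectiveCover_projectiveCoverMap _).exists_split
      (f (i + 1) (by omega)).surjective_rangeRestrict e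
    have : Module.Finite R K' :=
      Module.Finite.of_surjective r fun x => ⟨x, LinearMap.congr_fun hr x⟩
    refine ⟨FGModuleCat.of R K', Module.Projective.of_split K'.subtype r hr, ⟨?_⟩⟩
    rw [Function.iterate_succ_apply']
    refine (LinearEquiv.ofEq _ _ ?_).trans e'
    rw [LinearMap.ker_rangeRestrict, hf i (by omega)]

/-- A projective resolution `V₀ ⟶ ⋯ ⟶ V_d ⟶ M ⟶ 0` such that no summand of `V₀` lies in the
kernel of `V₀ ⟶ V₁` computes `Hom(A, τ_d M)`. -/
theorem finrank_hom_tauD {d : ℕ} (hd : 1 ≤ d)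
    (V : Fin (d + 2) → FGModuleCat.{v} R)
    (f : ∀ (i : ℕ) (h : i < d + 1), V ⟨i, by omega⟩ →ₗ[R] V ⟨i + 1, by omega⟩)
    (hV : ∀ (i : ℕ) (h : i < d + 1), Module.Projective R (V ⟨i, by omega⟩))
    (hf : ∀ (i : ℕ) (h : i < d),
      LinearMap.range (f i (by omega)) = LinearMap.ker (f (i + 1) (by omega)))
    (hfd : Function.Surjective (f d (by omega)))
    (hε : ∀ ε : V ⟨0, by omega⟩ →ₗ[R] V ⟨0, by omega⟩,
      ε ∘ₗ ε = ε → f 0 (by omega) ∘ₗ ε = 0 → ε = 0)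
    {M : FGModuleCat.{v} R} (e : V ⟨d + 1, by omega⟩ ≃ₗ[R] M)
    (A : FGModuleCat.{v} R) [Module k A] [IsScalarTower k R A] :
    Module.finrank k (A ⟶ tauD k d M)
      + Module.finrank k (LinearMap.range (LinearMap.lcomp k A (f 0 (by omega))))
      = Module.finrank k (V ⟨0, by omega⟩ →ₗ[R] A) := by
  have := isArtinianRing_of_finite k R
  obtain ⟨K, hK, ⟨e⟩⟩ := exists_range_equiv_iterate_syzygy V f hV hf hfd e (d - 1) 1 (by omega)
  have := hV 0 (by omega)
  have := hV 1 (by omega)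
  exact finrank_hom_tau k _ (f 0 (by omega)) (f 1 (by omega)).rangeRestrict
    (LinearMap.surjective_rangeRestrict _)
    (by rw [LinearMap.ker_rangeRestrict]; exact hf 0 (by omega)) e hε A

end Tau

/-! ### Exactness of Hom functors on angles. -/

section Angles

open scoped ZeroObject

variable {C : Type u} [Category.{v} C] [Preadditive C]

namespace Seq

variable {S : C ⥤ C} {d : ℕ}

/-- The objects of the left rotation. -/
def rotateX (A : Seq S d) (i : Fin (d + 2)) : C :=
  if h : i.val < d + 1 then A.X ⟨i.val + 1, by omega⟩ else S.obj (A.X ⟨0, by omega⟩)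

omit [Preadditive C] in
theorem rotateX_of_lt (A : Seq S d) (i : ℕ) (h : i < d + 1) :
    A.rotateX ⟨i, by omega⟩ = A.X ⟨i + 1, by omega⟩ :=
  dif_pos h

omit [Preadditive C] in
theorem rotateX_last (A : Seq S d) :
    A.rotateX ⟨d + 1, by omega⟩ = S.obj (A.X ⟨0, by omega⟩) :=
  dif_neg (by simp)

/-- A left rotation of a sequence. -/
def rotation (A : Seq S d) : Seq S d where
  X := A.rotateX
  f i h :=
    if h' : i < d then
      eqToHom (A.rotateX_of_lt i h) ≫ A.f (i + 1) (by omega) ≫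
        eqToHom (A.rotateX_of_lt (i + 1) (by omega)).symm
    else
      eqToHom ((A.rotateX_of_lt i h).trans (by congr 2; omega)) ≫ A.δ ≫
        eqToHom (A.rotateX_last.symm.trans (by congr 2; omega))
  δ := eqToHom A.rotateX_last ≫ ((-1 : ℤ) ^ (d + 2) • S.map (A.f 0 (by omega))) ≫
    S.map (eqToHom (A.rotateX_of_lt 0 (by omega)).symm)

/-- All objects of the left rotation but the last are shifted objects of the sequence. -/
def rotateIso (A : Seq S d) (i : ℕ) (h : i < d + 1) :
    A.rotation.X ⟨i, by omega⟩ ≅ A.X ⟨i + 1, by omega⟩ :=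
  eqToIso (A.rotateX_of_lt i h)

/-- The last object of the left rotation is the suspension of the first object. -/
def rotateIsoLast (A : Seq S d) :
    A.rotation.X ⟨d + 1, by omega⟩ ≅ S.obj (A.X ⟨0, by omega⟩) :=
  eqToIso A.rotateX_last

theorem rotation_f (A : Seq S d) (i : ℕ) (h : i < d) :
    A.rotation.f i (by omega) ≫ (A.rotateIso (i + 1) (by omega)).hom
      = (A.rotateIso i (by omega)).hom ≫ A.f (i + 1) (by omega) := by
  simp [rotation, rotateIso, h]

theorem rotation_f_last (A : Seq S d) :
    A.rotation.f d (by omega) ≫ A.rotateIsoLast.hom = (A.rotateIso d (by omega)).hom ≫ A.δ := by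
  have h : A.rotation.f d (by omega)
      = (A.rotateIso d (by omega)).hom ≫ A.δ ≫ A.rotateIsoLast.inv := dif_neg (lt_irrefl d)
  rw [h, Category.assoc, Category.assoc, Iso.inv_hom_id, Category.comp_id]

theorem rotation_δ (A : Seq S d) :
    A.rotation.δ ≫ S.map (A.rotateIso 0 (by omega)).hom
      = A.rotateIsoLast.hom ≫ ((-1 : ℤ) ^ (d + 2) • S.map (A.f 0 (by omega))) := by
  have h : A.rotation.δ = A.rotateIsoLast.hom ≫ ((-1 : ℤ) ^ (d + 2) • S.map (A.f 0 (by omega))) ≫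
    S.map (A.rotateIso 0 (by omega)).inv := rfl
  rw [h, Category.assoc, Category.assoc, ← Functor.map_comp, Iso.inv_hom_id, S.map_id,
    Category.comp_id]

theorem isLeftRotation_rotation (A : Seq S d) : A.IsLeftRotation A.rotation :=
  ⟨A.rotateIso, A.rotateIsoLast, A.rotation_f, A.rotation_f_last, A.rotation_δ⟩

variable [HasZeroObject C]

open scoped Classical in
/-- The sequence with `Z = Z` in positions `j` and `j + 1` and zeroes elsewhere. -/
def stalk (S : C ⥤ C) (d j : ℕ) (Z : C) : Seq S d where
  X i := if i.val = j ∨ i.val = j + 1 then Z else 0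
  f i h := if h : i = j then eqToHom (by simp [h]) else 0
  δ := 0

/-- The non-zero objects of the stalk sequence. -/
def stalkIso (S : C ⥤ C) (d j : ℕ) (Z : C) (i : Fin (d + 2)) (h : i.val = j ∨ i.val = j + 1) :
    (stalk S d j Z).X i ≅ Z :=
  eqToIso (if_pos h)

theorem isZero_stalk (S : C ⥤ C) (d j : ℕ) (Z : C) (i : Fin (d + 2))
    (h : ¬ (i.val = j ∨ i.val = j + 1)) : IsZero ((stalk S d j Z).X i) :=
  (isZero_zero C).of_iso (eqToIso (if_neg h))

theorem stalk_f (S : C ⥤ C) (d j : ℕ) (Z : C) (h : j < d + 1) :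
    (stalk S d j Z).f j h
      = (stalkIso S d j Z ⟨j, by omega⟩ (by simp)).hom ≫
        (stalkIso S d j Z ⟨j + 1, by omega⟩ (by simp)).inv := by
  simp [stalk, stalkIso]

end Seq

/-- A pair of morphisms on which all functors `C(W, -)` and `C(-, W)` are exact. -/
structure HomExact {X Y Z : C} (f : X ⟶ Y) (g : Y ⟶ Z) : Prop where
  zero : f ≫ g = 0
  lift : ∀ {W : C} (a : W ⟶ Y), a ≫ g = 0 → ∃ b : W ⟶ X, b ≫ f = a
  desc : ∀ {W : C} (a : Y ⟶ W), f ≫ a = 0 → ∃ b : Z ⟶ W, g ≫ b = a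

theorem HomExact.of_iso {X Y Z X' Y' Z' : C} {f : X ⟶ Y} {g : Y ⟶ Z} {f' : X' ⟶ Y'} {g' : Y' ⟶ Z'}
    (h : HomExact f g) (a : X ≅ X') (b : Y ≅ Y') (c : Z ≅ Z')
    (hf : f ≫ b.hom = a.hom ≫ f') (hg : g ≫ c.hom = b.hom ≫ g') : HomExact f' g' := by
  have h2 : g' ≫ c.inv = b.inv ≫ g := by
    rw [Iso.comp_inv_eq, Category.assoc, hg, Iso.inv_hom_id_assoc]
  refine ⟨?_, fun x hx => ?_, fun x hx => ?_⟩
  · rw [← cancel_epi a.hom, ← reassoc_of% hf, ← hg, reassoc_of% h.zero, zero_comp, comp_zero]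
  · obtain ⟨y, hy⟩ := h.lift (x ≫ b.inv) (by
      rw [Category.assoc, ← h2, reassoc_of% hx, zero_comp])
    exact ⟨y ≫ a.hom, by rw [Category.assoc, ← hf, reassoc_of% hy, Iso.inv_hom_id, Category.comp_id]⟩
  · obtain ⟨y, hy⟩ := h.desc (b.hom ≫ x) (by rw [reassoc_of% hf, hx, comp_zero])
    exact ⟨c.inv ≫ y, by rw [reassoc_of% h2, hy, Iso.inv_hom_id_assoc]⟩

theorem HomExact.of_neg_one_pow_smul {X Y Z : C} {f : X ⟶ Y} {g : Y ⟶ Z} {n : ℕ}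
    (h : HomExact f ((-1 : ℤ) ^ n • g)) : HomExact f g := by
  rcases neg_one_pow_eq_or ℤ n with hn | hn
  · simpa [hn] using h
  · rw [hn, neg_one_zsmul] at h
    refine ⟨by simpa using h.zero, fun a ha => h.lift a (by simp [ha]), fun a ha => ?_⟩
    obtain ⟨b, hb⟩ := h.desc a ha
    exact ⟨-b, by simpa using hb⟩

/-- This lemma and the next three are the diagram chases of `homExact_zero`, stated for arbitrary
objects to keep the indices and identifications of rotated and stalk sequences out of the way. -/
theorem comp_eq_zero_of_square {W₁ W₂ X₀ X₁ X₂ : C} {f₀ : X₀ ⟶ X₁} {f₁ : X₁ ⟶ X₂}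
    (hW : IsZero W₂) (e : W₁ ≅ X₀) (s : W₁ ⟶ W₂) (φ : W₂ ⟶ X₂)
    (h : s ≫ φ = (e.hom ≫ f₀) ≫ f₁) : f₀ ≫ f₁ = 0 := by
  rw [hW.eq_zero_of_src φ, comp_zero, Category.assoc] at h
  rw [← cancel_epi e.hom, ← h, comp_zero]

theorem exists_lift_of_square {S : C ⥤ C} [S.Additive] [S.Full] [S.Faithful]
    {A₀ A B₀ B W₀ W₁ X₀ X₁ Z : C} {f : X₀ ⟶ X₁} {a : A ⟶ S.obj A₀} {b : B ⟶ S.obj B₀} {w : W₀ ⟶ W₁}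
    (iA : A₀ ≅ X₁) (iB : B₀ ≅ W₁) (lA : A ≅ S.obj X₀) (lB : B ≅ S.obj W₀) (e₀ : W₀ ≅ Z)
    (e₁ : W₁ ≅ Z) {n : ℕ} (ha : a ≫ S.map iA.hom = lA.hom ≫ ((-1 : ℤ) ^ n • S.map f))
    (hb : b ≫ S.map iB.hom = lB.hom ≫ ((-1 : ℤ) ^ n • S.map w)) (hw : w = e₀.hom ≫ e₁.inv)
    (g : Z ⟶ X₁) (φ : B ⟶ A) (h : b ≫ S.map (iB.hom ≫ e₁.hom ≫ g ≫ iA.inv) = φ ≫ a) :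
    ∃ c : Z ⟶ X₀, c ≫ f = g := by
  obtain ⟨c, hc⟩ := S.map_surjective (S.map e₀.inv ≫ lB.inv ≫ φ ≫ lA.hom)
  refine ⟨c, S.map_injective ?_⟩
  have h' := congrArg (· ≫ S.map iA.hom) h
  simp only [Category.assoc, ha, ← Functor.map_comp, Iso.inv_hom_id, Category.comp_id] at h'
  rw [Functor.map_comp, reassoc_of% hb, hw] at h'
  have h2 : (-1 : ℤ) ^ n • (lB.hom ≫ S.map (e₀.hom ≫ g))
      = (-1 : ℤ) ^ n • (φ ≫ lA.hom ≫ S.map f) := by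
    simpa [← Functor.map_comp] using h'
  have h3 : lB.hom ≫ S.map (e₀.hom ≫ g) = φ ≫ lA.hom ≫ S.map f := by
    rcases neg_one_pow_eq_or ℤ n with hn | hn <;> simpa [hn] using h2
  rw [Functor.map_comp, hc]
  simp only [Category.assoc, ← h3, Iso.inv_hom_id_assoc, ← Functor.map_comp]

theorem comp_zero_eq_of_square {A₀ A₁ B₀ B₁ W₁ X₁ X₂ Z : C} {f : X₁ ⟶ X₂} {a : A₀ ⟶ A₁}
    (b : B₀ ⟶ B₁) (iA : A₀ ≅ X₁) (jA : A₁ ≅ X₂) (iB : B₀ ≅ W₁) (e : W₁ ≅ Z) (g : Z ⟶ X₁)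
    (ha : a ≫ jA.hom = iA.hom ≫ f) (hg : g ≫ f = 0) :
    b ≫ (0 : B₁ ⟶ A₁) = (iB.hom ≫ e.hom ≫ g ≫ iA.inv) ≫ a := by
  rw [← cancel_mono jA.hom]
  simp [ha, hg]

omit [Preadditive C] in
theorem exists_desc_of_square {W₁ W₂ X₁ X₂ Z : C} {f : X₁ ⟶ X₂} {w : W₁ ⟶ W₂} (e₁ : W₁ ≅ Z)
    (e₂ : W₂ ≅ Z) (hw : w = e₁.hom ≫ e₂.inv) (g : X₁ ⟶ Z) (φ : X₂ ⟶ W₂)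
    (h : f ≫ φ = (g ≫ e₁.inv) ≫ w) : ∃ c : X₂ ⟶ Z, f ≫ c = g :=
  ⟨φ ≫ e₂.hom, by rw [reassoc_of% h, hw]; simp⟩

namespace Angulation

variable [HasBinaryBiproducts C] {S : C ⥤ C} {d : ℕ} (𝒜 : Angulation S d)

theorem isAngle_rotation {A : Seq S d} (hA : 𝒜.IsAngle A) : 𝒜.IsAngle A.rotation :=
  (𝒜.rotate _ _ A.isLeftRotation_rotation).1 hA

variable [HasZeroObject C]

theorem isAngle_stalk_zero (Z : C) : 𝒜.IsAngle (Seq.stalk S d 0 Z) := by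
  refine 𝒜.trivial _ ⟨?_, fun i hi => Seq.isZero_stalk _ _ _ _ _ (by omega)⟩
  rw [Seq.stalk_f]
  infer_instance

variable [S.Additive]

/-- Its left rotation is trivial, and (F2) is an equivalence. -/
theorem isAngle_stalk_one (hd : 1 ≤ d) (Z : C) : 𝒜.IsAngle (Seq.stalk S d 1 Z) := by
  refine (𝒜.rotate _ _ (Seq.isLeftRotation_rotation _)).2 (𝒜.trivial _ ⟨?_, fun ⟨i, hi⟩ h2 => ?_⟩)
  · have h1 := (Iso.eq_comp_inv _).2 (Seq.rotation_f (Seq.stalk S d 1 Z) 0 (by omega))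
    have : IsIso ((Seq.stalk S d 1 Z).f (0 + 1) (by omega)) := by
      rw [Seq.stalk_f]
      infer_instance
    exact h1 ▸ inferInstance
  · have h2 : 2 ≤ i := h2
    by_cases h : i < d + 1
    · exact (Seq.isZero_stalk S d 1 Z ⟨i + 1, by omega⟩ (by simp; omega)).of_iso
        (Seq.rotateIso _ i h)
    · obtain rfl : i = d + 1 := by omega
      exact (S.map_isZero (Seq.isZero_stalk S d 1 Z ⟨0, by omega⟩ (by simp))).of_iso
        (Seq.rotateIsoLast _)

variable [S.Full] [S.Faithful] {A : Seq S d}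

theorem homExact_zero (hd : 1 ≤ d) (hA : 𝒜.IsAngle A) :
    HomExact (A.f 0 (by omega)) (A.f (0 + 1) (by omega)) := by
  refine ⟨?_, fun {Z} g hg => ?_, fun {Z} g hg => ?_⟩
  -- (F3) extends `(𝟙, f₀)` from the trivial angle on `X₀`, so `f₀ ≫ f₁` passes through a zero
  -- object.
  · let e₁ := Seq.stalkIso S d 0 (A.X ⟨0, by omega⟩) ⟨0 + 1, by omega⟩ (by simp)
    obtain ⟨Φ, h₀, h₁⟩ := 𝒜.complete _ A (𝒜.isAngle_stalk_zero (A.X ⟨0, by omega⟩)) hA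
      (Seq.stalkIso S d 0 _ ⟨0, by omega⟩ (by simp)).hom (e₁.hom ≫ A.f 0 (by omega)) (by
        rw [Seq.stalk_f, Category.assoc]
        exact congrArg _ (Iso.inv_hom_id_assoc _ _))
    refine comp_eq_zero_of_square (Seq.isZero_stalk S d 0 (A.X ⟨0, by omega⟩)
      ⟨0 + 1 + 1, by omega⟩ (by simp)) e₁ _ (Φ.φ _)
      ((Φ.comm (0 + 1) (by omega)).trans (congrArg (· ≫ A.f (0 + 1) (by omega)) h₁))
  -- After rotation, (F3) extends `(g, 0)` to a morphism whose last component is a map `S Z ⟶ S X₀`.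
  -- Fullness desuspends it to the lift; the signs in the two rotations agree.
  · let B := Seq.stalk S d 0 Z
    let e₁ := Seq.stalkIso S d 0 Z ⟨0 + 1, by omega⟩ (by simp)
    obtain ⟨Φ, h₀, -⟩ := 𝒜.complete _ _ (𝒜.isAngle_rotation (𝒜.isAngle_stalk_zero Z))
      (𝒜.isAngle_rotation hA)
      ((B.rotateIso 0 (by omega)).hom ≫ e₁.hom ≫ g ≫ (A.rotateIso 0 (by omega)).inv) 0
      (comp_zero_eq_of_square _ _ (A.rotateIso (0 + 1) (by omega)) _ _ _
        (A.rotation_f 0 (by omega)) hg)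
    exact exists_lift_of_square (A.rotateIso 0 (by omega)) (B.rotateIso 0 (by omega))
      A.rotateIsoLast B.rotateIsoLast (Seq.stalkIso S d 0 Z ⟨0, by omega⟩ (by simp)) e₁
      A.rotation_δ B.rotation_δ (Seq.stalk_f S d 0 Z (by omega)) g (Φ.φ ⟨d + 1, by omega⟩)
      (h₀ ▸ Φ.comm_last)
  -- (F3) extends `(0, g)` to a morphism into the angle `0 ⟶ Z = Z ⟶ 0 ⟶ ⋯`; its component at
  -- position `2` is the extension of `g`.
  · let e₁ := Seq.stalkIso S d 1 Z ⟨0 + 1, by omega⟩ (by simp)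
    obtain ⟨Φ, -, h₁⟩ := 𝒜.complete A _ hA (𝒜.isAngle_stalk_one hd Z) 0 (g ≫ e₁.inv)
      (((Category.assoc _ _ _).symm.trans (congrArg (· ≫ e₁.inv) hg)).trans
        (zero_comp.trans zero_comp.symm))
    exact exists_desc_of_square e₁ (Seq.stalkIso S d 1 Z ⟨0 + 1 + 1, by omega⟩ (by simp))
      (Seq.stalk_f S d 1 Z (by omega)) g (Φ.φ ⟨0 + 1 + 1, by omega⟩)
      ((Φ.comm (0 + 1) (by omega)).trans (congrArg (· ≫ Seq.f _ (0 + 1) (by omega)) h₁))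

theorem homExact_f (i : ℕ) (h : i < d) :
    ∀ {A : Seq S d}, 𝒜.IsAngle A → HomExact (A.f i (by omega)) (A.f (i + 1) (by omega)) := by
  induction i with
  | zero => exact fun hA => 𝒜.homExact_zero (by omega) hA
  | succ i ih =>
    exact fun {A} hA => (ih (by omega) (𝒜.isAngle_rotation hA)).of_iso (A.rotateIso i (by omega))
      (A.rotateIso (i + 1) (by omega)) (A.rotateIso (i + 2) (by omega))
      (A.rotation_f i (by omega)) (A.rotation_f (i + 1) (by omega))

theorem homExact_f_δ (hd : 1 ≤ d) (hA : 𝒜.IsAngle A) : HomExact (A.f d (by omega)) A.δ := by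
  obtain ⟨m, rfl⟩ : ∃ m, d = m + 1 := ⟨d - 1, by omega⟩
  exact (𝒜.homExact_f m (by omega) (𝒜.isAngle_rotation hA)).of_iso (A.rotateIso m (by omega))
    (A.rotateIso (m + 1) (by omega)) A.rotateIsoLast
    (A.rotation_f m (by omega)) A.rotation_f_last

theorem homExact_δ (hd : 1 ≤ d) (hA : 𝒜.IsAngle A) :
    HomExact A.δ (S.map (A.f 0 (by omega))) :=
  ((𝒜.homExact_f_δ hd (𝒜.isAngle_rotation hA)).of_iso (A.rotateIso d (by omega))
    A.rotateIsoLast (S.mapIso (A.rotateIso 0 (by omega)))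
    A.rotation_f_last A.rotation_δ).of_neg_one_pow_smul

end Angulation

end Angles

/-! ### The additive closure of `T` through dual bases. -/

section AdditiveClosure

variable {C : Type u} [Category.{v} C] [Preadditive C]

/-- The identity of `Z` is a finite sum of morphisms that factor through `T`. -/
def HasDualBasis (T Z : C) : Prop :=
  ∃ (n : ℕ) (a : Fin n → (Z ⟶ T)) (b : Fin n → (T ⟶ Z)), ∑ j, a j ≫ b j = 𝟙 Z

namespace HasDualBasis

variable {T Z W : C}

theorem self (T : C) : HasDualBasis T T := ⟨1, fun _ => 𝟙 T, fun _ => 𝟙 T, by simp⟩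

theorem map {D : Type*} [Category* D] [Preadditive D] (F : C ⥤ D) [F.Additive]
    (h : HasDualBasis T Z) : HasDualBasis (F.obj T) (F.obj Z) := by
  obtain ⟨n, a, b, hab⟩ := h
  exact ⟨n, fun j => F.map (a j), fun j => F.map (b j), by
    simp only [← F.map_comp, ← F.map_sum, hab, F.map_id]⟩

theorem congr_left (e : T ≅ W) (h : HasDualBasis T Z) : HasDualBasis W Z := by
  obtain ⟨n, a, b, hab⟩ := h
  exact ⟨n, fun j => a j ≫ e.hom, fun j => e.inv ≫ b j, by simpa using hab⟩

theorem of_retract (h : HasDualBasis T Z) (i : W ⟶ Z) (r : Z ⟶ W) (hir : i ≫ r = 𝟙 W) :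
    HasDualBasis T W := by
  obtain ⟨n, a, b, hab⟩ := h
  refine ⟨n, fun j => i ≫ a j, fun j => b j ≫ r, ?_⟩
  have : i ≫ (∑ j, a j ≫ b j) ≫ r = 𝟙 W := by rw [hab, Category.id_comp, hir]
  simpa [Preadditive.comp_sum, Preadditive.sum_comp] using this

theorem ext_src (h : HasDualBasis T Z) {f g : Z ⟶ W} (hfg : ∀ b : T ⟶ Z, b ≫ f = b ≫ g) :
    f = g := by
  obtain ⟨n, a, b, hab⟩ := h
  rw [← Category.id_comp f, ← Category.id_comp g, ← hab, Preadditive.sum_comp,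
    Preadditive.sum_comp]
  simp [hfg]

theorem ext_tgt (h : HasDualBasis T Z) {f g : W ⟶ Z} (hfg : ∀ a : Z ⟶ T, f ≫ a = g ≫ a) :
    f = g := by
  obtain ⟨n, a, b, hab⟩ := h
  rw [← Category.comp_id f, ← Category.comp_id g, ← hab, Preadditive.comp_sum,
    Preadditive.comp_sum]
  simp only [reassoc_of% hfg]

/-- If there are no non-zero morphisms from `T` to `W`, the same holds between their additive
closures. -/
theorem hom_eq_zero {Z' : C} (h : HasDualBasis T Z) (h' : HasDualBasis W Z')
    (h0 : Subsingleton (T ⟶ W)) (f : Z ⟶ Z') : f = 0 :=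
  h.ext_src fun _ => h'.ext_tgt fun _ => Subsingleton.elim _ _

end HasDualBasis

variable [HasFiniteBiproducts C]

theorem InAdd.hasDualBasis {T Z : C} (h : InAdd T Z) : HasDualBasis T Z := by
  obtain ⟨n, W, ⟨e⟩⟩ := h
  refine HasDualBasis.of_retract (Z := ⨁ fun _ : Fin n => T)
    ⟨n, biproduct.π _, biproduct.ι _, biproduct.total⟩ (biprod.inl ≫ e.inv) (e.hom ≫ biprod.fst)
    (by simp)

/-- The complement is obtained by splitting the idempotent `𝟙 X - r ≫ i`. -/
theorem isSummand_of_retract [IsIdempotentComplete C] {X Z : C} (i : Z ⟶ X) (r : X ⟶ Z)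
    (h : i ≫ r = 𝟙 Z) : IsSummand Z X := by
  obtain ⟨W, j, s, hjs, hsj⟩ := IsIdempotentComplete.idempotents_split X (𝟙 X - r ≫ i) (by
    simp [reassoc_of% h])
  have hjr : j ≫ r = 0 := by
    have : j ≫ (s ≫ j) ≫ r = 0 := by rw [hsj]; simp [h]
    simpa [reassoc_of% hjs] using this
  have his : i ≫ s = 0 := by
    have : i ≫ (s ≫ j) ≫ s = 0 := by rw [hsj]; simp [reassoc_of% h]
    simpa [hjs] using this
  refine ⟨W, ⟨⟨biprod.lift r s, biprod.desc i j, by simp [hsj], ?_⟩⟩⟩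
  ext <;> simp [h, hjr, his, hjs]

theorem HasDualBasis.inAdd [IsIdempotentComplete C] {T Z : C} (h : HasDualBasis T Z) :
    InAdd T Z := by
  obtain ⟨n, a, b, hab⟩ := h
  exact ⟨n, isSummand_of_retract (biproduct.lift a) (biproduct.desc b) (by
    rw [biproduct.lift_desc, hab])⟩

end AdditiveClosure

/-! ### The functor `C(T, -)` on `add T`. -/

section HomModules

variable (k : Type w) [Field k] {C : Type u} [Category.{v} C] [Preadditive C] [Linear k C]
  [HomFinite k C] {T : C}

instance (X : C) : Module k (homModule k T X) := inferInstanceAs (Module k (T ⟶ X))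

instance (X : C) : IsScalarTower k (End T)ᵐᵒᵖ (homModule k T X) :=
  ⟨fun c r (x : T ⟶ X) => Linear.smul_comp _ _ _ c r.unop x⟩

/-- The map `C(T, X) ⟶ C(T, Y)` induced by `f : X ⟶ Y`. -/
def homMap (T : C) {X Y : C} (f : X ⟶ Y) : homModule k T X →ₗ[(End T)ᵐᵒᵖ] homModule k T Y :=
  ((preadditiveCoyonedaObj T).map f).hom

/-- The functor `C(T, -)` on Hom-spaces. -/
def homMapLinear (T X Y : C) :
    (X ⟶ Y) →ₗ[k] (homModule k T X →ₗ[(End T)ᵐᵒᵖ] homModule k T Y) where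
  toFun := homMap k T
  map_add' f g := LinearMap.ext fun (x : T ⟶ X) => Preadditive.comp_add _ _ _ x f g
  map_smul' c f := LinearMap.ext fun (x : T ⟶ X) => Linear.comp_smul _ _ _ x c f

/-- A `Γ`-linear `φ` is determined by its values on the `b j`, and `∑ j, a j ≫ φ (b j)` induces it.
-/
theorem HasDualBasis.homMapLinear_bijective {Z : C} (h : HasDualBasis T Z) (W : C) :
    Function.Bijective (homMapLinear k T Z W) := by
  refine ⟨fun f g hfg => h.ext_src fun b => LinearMap.congr_fun hfg b, fun φ => ?_⟩
  obtain ⟨n, a, b, hab⟩ := h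
  let φ' : (T ⟶ Z) → (T ⟶ W) := φ
  have hφ : ∀ (r : T ⟶ T) (x : T ⟶ Z), φ' (r ≫ x) = r ≫ φ' x := fun r x =>
    map_smul φ (MulOpposite.op r : (End T)ᵐᵒᵖ) x
  let φ'' : (T ⟶ Z) →+ (T ⟶ W) := AddMonoidHom.mk' φ' (map_add φ)
  refine ⟨∑ j, a j ≫ φ' (b j), LinearMap.ext fun (x : T ⟶ Z) => ?_⟩
  change x ≫ ∑ j, a j ≫ φ' (b j) = φ'' x
  conv_rhs => rw [← Category.comp_id x, ← hab, Preadditive.comp_sum, map_sum]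
  rw [Preadditive.comp_sum]
  refine Finset.sum_congr rfl fun j _ => ?_
  rw [← Category.assoc, ← Category.assoc]
  exact (hφ _ _).symm

theorem HasDualBasis.projective {Z : C} (h : HasDualBasis T Z) :
    Module.Projective (End T)ᵐᵒᵖ (homModule k T Z) := by
  obtain ⟨n, a, b, hab⟩ := h
  refine Module.Projective.of_split (M := Fin n → (End T)ᵐᵒᵖ)
    (LinearMap.pi fun j =>
      { toFun := fun x : T ⟶ Z => MulOpposite.op (x ≫ a j)
        map_add' := fun (x y : T ⟶ Z) => congrArg MulOpposite.op (Preadditive.add_comp _ _ _ x y _)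
        map_smul' := fun r (x : T ⟶ Z) => congrArg MulOpposite.op (Category.assoc r.unop x (a j)) })
    (Fintype.linearCombination (End T)ᵐᵒᵖ (fun j => (b j : homModule k T Z)))
    (LinearMap.ext fun (x : T ⟶ Z) => ?_)
  change ∑ j, (x ≫ a j) ≫ b j = x
  simp only [Category.assoc, ← Preadditive.comp_sum, hab, Category.comp_id]

end HomModules

section Ranks

theorem finrank_range_congr {k V W V' W' : Type*} [Field k] [AddCommGroup V] [Module k V]
    [AddCommGroup W] [Module k W] [AddCommGroup V'] [Module k V'] [AddCommGroup W'] [Module k W']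
    (f : V →ₗ[k] W) (f' : V' →ₗ[k] W') (e : V ≃ₗ[k] V') (e' : W ≃ₗ[k] W')
    (h : ∀ x, e' (f x) = f' (e x)) :
    Module.finrank k (LinearMap.range f) = Module.finrank k (LinearMap.range f') := by
  have : LinearMap.range f' = (LinearMap.range f).map (e' : W →ₗ[k] W') := by
    rw [← LinearMap.range_comp, ← LinearMap.range_comp_of_range_eq_top f' e.range]
    congr 1
    ext x
    exact (h x).symm
  rw [this]
  exact (LinearEquiv.finrank_map_eq e' _).symm

end Ranks

/-! ### Transport along the suspension. -/

section Equivalence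

variable (k : Type w) [Field k] {C : Type u} [Category.{v} C] [Preadditive C] [Linear k C]

/-- A fully faithful linear functor on Hom-spaces. -/
def mapHomEquiv {S : C ⥤ C} [S.Additive] [S.Linear k] [S.Full] [S.Faithful] (X Y : C) :
    (X ⟶ Y) ≃ₗ[k] (S.obj X ⟶ S.obj Y) :=
  LinearEquiv.ofBijective (S.mapLinearMap k) ⟨S.map_injective, S.map_surjective⟩

/-- Essential surjectivity covers sources `W` that are not themselves suspensions. -/
theorem HomExact.lift_map {S : C ⥤ C} [S.Full] [S.Faithful] [S.Additive] [S.EssSurj] {X Y Z W : C}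
    {f : X ⟶ Y} {g : Y ⟶ Z} (h : HomExact f g) (a : W ⟶ S.obj Y) (ha : a ≫ S.map g = 0) :
    ∃ b : W ⟶ S.obj X, b ≫ S.map f = a := by
  let e := S.objObjPreimageIso W
  obtain ⟨a', ha'⟩ := S.map_surjective (e.hom ≫ a)
  obtain ⟨b, hb⟩ := h.lift a' (S.map_injective (by
    rw [S.map_comp, ha', Category.assoc, ha, comp_zero, S.map_zero]))
  exact ⟨e.inv ≫ S.map b, by
    rw [Category.assoc, ← S.map_comp, hb, ha', Iso.inv_hom_id_assoc]⟩

end Equivalence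

/-! ### From cluster tilting angles to `τ_d`. -/

section Resolutions

variable (k : Type v) [Field k] {C : Type u} [Category.{v} C] [Preadditive C] [Linear k C]
  [HomFinite k C]

/-- The end `L ⟶ Y ⟶ S K` of a `(d+2)`-angle that starts in `K` with all objects but `Y` in
`add T`, and computes `τ_d C(T, Y)`. -/
structure TiltingResolution (S : C ⥤ C) (d : ℕ) (T Y : C) where
  K : C
  L : C
  p : L ⟶ Y
  δ : Y ⟶ S.obj K
  hK : HasDualBasis T K
  hL : HasDualBasis T L
  exact : HomExact p δ
  -- The right-hand side is the dimension of the space of morphisms `Y ⟶ S X` that factor through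
  -- `δ`.
  finrank_tauD : ∀ X : C,
    Module.finrank k (homModule k T X ⟶ tauD k d (homModule k T Y))
      = Module.finrank k (LinearMap.range (Linear.leftComp k (S.obj X) δ))

variable {k} {S : C ⥤ C} {d : ℕ} {T Y : C}

theorem finrank_homMap_lcomp {X₀ X₁ : C} (h₀ : HasDualBasis T X₀) (h₁ : HasDualBasis T X₁)
    (f : X₀ ⟶ X₁) (X : C) :
    Module.finrank k (LinearMap.range (LinearMap.lcomp k (homModule k T X) (homMap k T f)))
      = Module.finrank k (LinearMap.range (Linear.leftComp k X f)) :=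
  (finrank_range_congr _ _ (LinearEquiv.ofBijective _ (h₁.homMapLinear_bijective k X))
    (LinearEquiv.ofBijective _ (h₀.homMapLinear_bijective k X)) fun g =>
      LinearMap.ext fun (x : T ⟶ X₀) => (Category.assoc x f g).symm).symm

variable [S.Additive] [S.Linear k] [S.Full] [S.Faithful]

theorem finrank_range_leftComp_δ {X₀ X₁ Z : C} {f : X₀ ⟶ X₁} {δ : Z ⟶ S.obj X₀}
    (h : HomExact δ (S.map f)) (X : C) :
    Module.finrank k (LinearMap.range (Linear.leftComp k (S.obj X) δ))
      + Module.finrank k (LinearMap.range (Linear.leftComp k X f))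
      = Module.finrank k (X₀ ⟶ X) := by
  have := HomFinite.finite_hom (k := k) (S.obj X₀) (S.obj X)
  have h1 : LinearMap.ker (Linear.leftComp k (S.obj X) δ)
      = LinearMap.range (Linear.leftComp k (S.obj X) (S.map f)) := by
    ext a
    refine ⟨fun ha => ?_, ?_⟩
    · obtain ⟨b, hb⟩ := h.desc a ha
      exact ⟨b, hb⟩
    · rintro ⟨b, rfl⟩
      exact (Category.assoc _ _ _).symm.trans (by rw [h.zero, zero_comp])
  rw [finrank_range_congr (Linear.leftComp k X f) (Linear.leftComp k (S.obj X) (S.map f))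
    (mapHomEquiv k _ _) (mapHomEquiv k _ _) (fun g => S.map_comp f g), ← h1,
    LinearMap.finrank_range_add_finrank_ker, (mapHomEquiv k (S := S) X₀ X).finrank_eq]

theorem exists_tiltingResolution [HasFiniteBiproducts C] [IsIdempotentComplete C] (hd : 1 ≤ d) (𝒜 : Angulation S d)
    (hT : IsClusterTilting 𝒜 T) (hY : ∀ Z : C, IsSummand Z Y → InAdd (S.obj T) Z → IsZero Z) :
    Nonempty (TiltingResolution k S d T Y) := by
  obtain ⟨A, hA, hAT, ⟨e⟩⟩ := hT.2 Y
  have hb : ∀ (i : ℕ) (h : i < d + 1), HasDualBasis T (A.X ⟨i, by omega⟩) :=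
    fun i h => (hAT i h).hasDualBasis
  have hlast := 𝒜.homExact_f_δ hd hA
  have hδ := 𝒜.homExact_δ hd hA
  have hε : ∀ ε : homModule k T (A.X ⟨0, by omega⟩) →ₗ[(End T)ᵐᵒᵖ] homModule k T (A.X ⟨0, by omega⟩),
      ε ∘ₗ ε = ε → homMap k T (A.f 0 (by omega)) ∘ₗ ε = 0 → ε = 0 := by
    intro ε h1 h2
    have hinj := fun W => ((hb 0 (by omega)).homMapLinear_bijective k W).1
    obtain ⟨ε, rfl⟩ := ((hb 0 (by omega)).homMapLinear_bijective k _).2 ε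
    replace h1 : ε ≫ ε = ε := hinj _ (LinearMap.ext fun (x : T ⟶ _) =>
      (Category.assoc _ _ _).symm.trans (LinearMap.congr_fun h1 x))
    replace h2 : ε ≫ A.f 0 (by omega) = 0 := hinj _ (LinearMap.ext fun (x : T ⟶ _) =>
      (Category.assoc _ _ _).symm.trans ((LinearMap.congr_fun h2 x).trans (comp_zero (X := T)).symm))
    -- Since `S ε` factors through `δ`, the suspension of the image `Z` of `ε` is a retract of `Y`
    -- lying in `add S T`, and `hY` forces it to vanish.
    obtain ⟨g, hg⟩ := hδ.lift (S.map ε) (by rw [← S.map_comp, h2, S.map_zero])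
    obtain ⟨Z, i, r, hir, hri⟩ := IsIdempotentComplete.idempotents_split _ ε h1
    have hZ : IsZero (S.obj Z) := by
      refine hY _ (isSummand_of_retract (S.map i ≫ g ≫ e.hom) (e.inv ≫ A.δ ≫ S.map r) ?_)
        (((hb 0 (by omega)).of_retract i r hir).map S).inAdd
      simp only [Category.assoc, Iso.hom_inv_id_assoc, reassoc_of% hg, ← S.map_comp]
      rw [← hri, Category.assoc, hir, Category.comp_id, hir, S.map_id]
    have hi : i = 0 := S.map_injective (by rw [S.map_zero]; exact hZ.eq_zero_of_src _)
    rw [← hri, hi, comp_zero, map_zero]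
  refine ⟨⟨A.X ⟨0, by omega⟩, A.X ⟨d, by omega⟩, A.f d (by omega) ≫ e.hom, e.inv ≫ A.δ,
    hb _ (by omega), hb _ (by omega), hlast.of_iso (Iso.refl _) e (Iso.refl _)
      (Category.id_comp _).symm ((Category.comp_id _).trans (Iso.hom_inv_id_assoc _ _).symm),
    fun X => ?_⟩⟩
  have hδ' : HomExact (e.inv ≫ A.δ) (S.map (A.f 0 (by omega))) :=
    hδ.of_iso e (Iso.refl _) (Iso.refl _)
      ((Category.comp_id _).trans (Iso.hom_inv_id_assoc _ _).symm)
      ((Category.comp_id _).trans (Category.id_comp _).symm)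
  have h1 := finrank_range_leftComp_δ (k := k) hδ' X
  have h2 := finrank_hom_tauD k hd (fun i => homModule k T (A.X i))
    (fun i h => homMap k T (A.f i h)) (fun i h => (hb i h).projective k)
    (fun i h => by
      have hi := 𝒜.homExact_f i h hA
      refine le_antisymm ?_ fun (x : T ⟶ _) hx => hi.lift x hx
      rintro _ ⟨x, rfl⟩
      exact (Category.assoc (show T ⟶ _ from x) _ _).trans (by rw [hi.zero]; exact comp_zero))
    -- Surjectivity at the right end: by rigidity, every morphism from `T` composes to zero with
    -- `δ`.
    (fun (x : T ⟶ _) => hlast.lift x ((HasDualBasis.self T).hom_eq_zero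
      ((hb 0 (by omega)).map S) hT.1 _)) hε (M := homModule k T Y)
    ((preadditiveCoyonedaObj T).mapIso e).toLinearEquiv (homModule k T X)
  rw [finrank_homMap_lcomp (hb 0 (by omega)) (hb 1 (by omega)),
    ← (LinearEquiv.ofBijective _ ((hb 0 (by omega)).homMapLinear_bijective k X)).finrank_eq] at h2
  omega

end Resolutions

/-! ### Calabi–Yau symmetry and the sum of the two `τ_d` terms. -/

section CalabiYau

variable {k : Type v} [Field k] {C : Type u} [Category.{v} C] [Preadditive C] [Linear k C]
  {S : C ⥤ C} {d : ℕ} {T X Y : C}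

theorem IsTwiceCalabiYau.finrank_hom (h : IsTwiceCalabiYau k S) (X Y : C) :
    Module.finrank k (X ⟶ Y) = Module.finrank k (Y ⟶ S.obj (S.obj X)) := by
  obtain ⟨e, -⟩ := h
  rw [(e X Y).finrank_eq, Subspace.dual_finrank_eq]

variable [S.Additive] [S.Linear k] [S.Full] [S.Faithful]

theorem IsTwiceCalabiYau.finrank_hom_shift (h : IsTwiceCalabiYau k S) (X Y : C) :
    Module.finrank k (X ⟶ S.obj Y) = Module.finrank k (Y ⟶ S.obj X) := by
  rw [h.finrank_hom, (mapHomEquiv k (S := S) Y (S.obj X)).finrank_eq]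

variable [HomFinite k C]

/-- By naturality of the duality, precomposition with `δ` is dual to postcomposition with `S (S δ)`.
Dual maps have equal rank, and one suspension is then removed. -/
theorem IsTwiceCalabiYau.finrank_range_leftComp (h : IsTwiceCalabiYau k S) {K : C}
    (δ : X ⟶ S.obj K) :
    Module.finrank k (LinearMap.range (Linear.leftComp k (S.obj Y) δ))
      = Module.finrank k (LinearMap.range (Linear.rightComp k Y (S.map δ))) := by
  obtain ⟨e, he⟩ := h
  have := HomFinite.finite_hom (k := k) (S.obj Y) (S.obj (S.obj (S.obj K)))
  have := HomFinite.finite_hom (k := k) (S.obj Y) (S.obj (S.obj X))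
  rw [finrank_range_congr (Linear.leftComp k (S.obj Y) δ)
    (Linear.rightComp k (S.obj Y) (S.map (S.map δ))).dualMap (e _ _) (e _ _)
    (fun x => LinearMap.ext fun g => by simpa using he δ (𝟙 _) x g),
    LinearMap.finrank_range_dualMap_eq_finrank_range]
  exact (finrank_range_congr _ _ (mapHomEquiv k _ _) (mapHomEquiv k _ _)
    fun g => S.map_comp g (S.map δ)).symm

theorem TiltingResolution.finrank_add [S.EssSurj] (hCY : IsTwiceCalabiYau k S)
    (hT : Subsingleton (ExtD S T T))
    (rX : TiltingResolution k S d T X) (rY : TiltingResolution k S d T Y) :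
    Module.finrank k (homModule k T X ⟶ tauD k d (homModule k T Y))
      + Module.finrank k (homModule k T Y ⟶ tauD k d (homModule k T X))
      = Module.finrank k (X ⟶ S.obj Y) := by
  rw [rX.finrank_tauD, rY.finrank_tauD, hCY.finrank_range_leftComp rX.δ, hCY.finrank_hom_shift X Y]
  have := HomFinite.finite_hom (k := k) Y (S.obj X)
  -- The inclusion `≤` uses `C(K_Y, S K_X) = 0`. For `≥`, a morphism killed by `S δ_X` lifts through
  -- `S L_X`, hence dies on `L_Y` because `C(L_Y, S L_X) = 0`, and so extends along `δ_Y`.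
  have h1 : LinearMap.range (Linear.leftComp k (S.obj X) rY.δ)
      = LinearMap.ker (Linear.rightComp k Y (S.map rX.δ)) := by
    refine le_antisymm ?_ fun g hg => ?_
    · rintro _ ⟨b, rfl⟩
      obtain ⟨b, rfl⟩ := S.map_surjective b
      change (rY.δ ≫ S.map b) ≫ S.map rX.δ = 0
      rw [Category.assoc, ← S.map_comp, rY.hK.hom_eq_zero (rX.hK.map S) hT (b ≫ rX.δ), S.map_zero, comp_zero]
    · obtain ⟨c, rfl⟩ := rX.exact.lift_map g hg
      exact rY.exact.desc _ (by
        rw [← Category.assoc, rY.hL.hom_eq_zero (rX.hL.map S) hT (rY.p ≫ c), zero_comp])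
  rw [h1, add_comm, LinearMap.finrank_range_add_finrank_ker]

end CalabiYau

/-! ### Additivity of Hom dimensions. -/

section Biproducts

variable (k : Type w) [Field k] {C : Type u} [Category.{v} C] [Preadditive C] [Linear k C]
  [HomFinite k C] [HasBinaryBiproducts C]

theorem finrank_hom_of_biprod (A B Z : C) :
    Module.finrank k (A ⊞ B ⟶ Z) = Module.finrank k (A ⟶ Z) + Module.finrank k (B ⟶ Z) := by
  have := HomFinite.finite_hom (k := k) A Z
  have := HomFinite.finite_hom (k := k) B Z
  rw [← Module.finrank_prod]
  exact LinearEquiv.finrank_eq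
    { toFun := fun f => (biprod.inl ≫ f, biprod.inr ≫ f)
      map_add' := fun f g => by simp
      map_smul' := fun c f => by simp
      invFun := fun p => biprod.desc p.1 p.2
      left_inv := fun f => by ext <;> simp
      right_inv := fun p => by simp }

theorem finrank_hom_to_map_biprod (S : C ⥤ C) [S.Additive] (A B Z : C) :
    Module.finrank k (Z ⟶ S.obj (A ⊞ B))
      = Module.finrank k (Z ⟶ S.obj A) + Module.finrank k (Z ⟶ S.obj B) := by
  have := HomFinite.finite_hom (k := k) Z (S.obj A)
  have := HomFinite.finite_hom (k := k) Z (S.obj B)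
  rw [← Module.finrank_prod]
  exact LinearEquiv.finrank_eq
    { toFun := fun f => (f ≫ S.map biprod.fst, f ≫ S.map biprod.snd)
      map_add' := fun f g => by simp
      map_smul' := fun c f => by simp
      invFun := fun p => p.1 ≫ S.map biprod.inl + p.2 ≫ S.map biprod.inr
      left_inv := fun f => by
        simp only [Category.assoc, ← S.map_comp, ← Preadditive.comp_add, ← S.map_add,
          biprod.total, S.map_id, Category.comp_id]
      right_inv := fun p => by
        simp [← S.map_comp] }

end Biproducts

/-! ### Assembling the dimension formula. -/

section Formula

/-- Finiteness lets an identity of `finrank` be read as one of `Module.rank`, where rank zero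
detects the zero space. -/
theorem finite_fgHom (k : Type v) {R : Type v} [Field k] [Ring R] [Algebra k R] [Module.Finite k R]
    (M N : FGModuleCat.{v} R) : Module.Finite k (M ⟶ N) := by
  let : Module k N := Module.restrictScalars k R N
  have : IsScalarTower k R N := IsScalarTower.restrictScalars k R N
  have : Module.Finite k N := Module.Finite.trans R N
  have := finite_linearMap k (R := R) (P := M) N
  exact Module.Finite.equiv (homLinearEquiv k M N).symm

variable {k : Type v} [Field k] {C : Type u} [Category.{v} C] [Preadditive C] [Linear k C]
  [HomFinite k C]

theorem finrank_homModule_hom {T Z : C} (h : HasDualBasis T Z) (W : C) :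
    Module.finrank k (homModule k T Z ⟶ homModule k T W) = Module.finrank k (Z ⟶ W) := by
  rw [(homLinearEquiv k _ (homModule k T W)).finrank_eq,
    (LinearEquiv.ofBijective _ (h.homMapLinear_bijective k W)).finrank_eq]

variable [HasFiniteBiproducts C] {S : C ≌ C} [S.functor.Additive] [S.functor.Linear k] {T X : C}

/-- Desuspending `D.rest` gives an object of `add T`, where `C(T, -)` is fully faithful; suspending
again gives the right-hand side. -/
theorem Decomposition.finrank_P_hom (D : Decomposition S.functor T X) (W : C) :
    Module.finrank k (D.P k ⟶ homModule k T W) = Module.finrank k (D.rest ⟶ S.functor.obj W) := by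
  have h : HasDualBasis T (S.inverse.obj D.rest) :=
    (D.rest_inAdd.hasDualBasis.map S.inverse).congr_left (S.unitIso.app T).symm
  rw [Decomposition.P, finrank_homModule_hom h, (mapHomEquiv k (S := S.functor) _ _).finrank_eq]
  exact (Linear.homCongr k (S.counitIso.app D.rest) (Iso.refl _)).finrank_eq

theorem finrank_extD {d : ℕ} [IsIdempotentComplete C] (hd : 1 ≤ d) (𝒜 : Angulation S.functor d)
    (hCY : IsTwiceCalabiYau k S.functor) (hT : IsClusterTilting 𝒜 T) {Y : C}
    (DX : Decomposition S.functor T X) (DY : Decomposition S.functor T Y) :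
    Module.finrank k (ExtD S.functor X Y) =
        Module.finrank k (DX.M k ⟶ tauD k d (DY.M k))
        + Module.finrank k (DY.M k ⟶ tauD k d (DX.M k))
        + Module.finrank k (DX.P k ⟶ DY.M k)
        + Module.finrank k (DY.P k ⟶ DX.M k) := by
  obtain ⟨rX⟩ := exists_tiltingResolution (k := k) hd 𝒜 hT DX.isZero_of_isSummand
  obtain ⟨rY⟩ := exists_tiltingResolution (k := k) hd 𝒜 hT DY.isZero_of_isSummand
  have h1 := TiltingResolution.finrank_add hCY hT.1 rX rY
  have h2 := DX.finrank_P_hom (k := k) DY.main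
  have h3 := DY.finrank_P_hom (k := k) DX.main
  have h4 : Module.finrank k (DX.rest ⟶ S.functor.obj DY.rest) = 0 := by
    have h0 : Subsingleton (S.functor.obj T ⟶ S.functor.obj (S.functor.obj T)) :=
      have := hT.1
      (mapHomEquiv k (S := S.functor) T (S.functor.obj T)).symm.toEquiv.subsingleton
    have : Subsingleton (DX.rest ⟶ S.functor.obj DY.rest) :=
      subsingleton_of_forall_eq 0 fun f => DX.rest_inAdd.hasDualBasis.hom_eq_zero
        (DY.rest_inAdd.hasDualBasis.map S.functor) h0 f
    exact Module.finrank_zero_of_subsingleton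
  -- The block from `X'` to `S Y''` is turned around by Calabi–Yau symmetry, so that `h3` applies to
  -- it.
  have h5 := hCY.finrank_hom_shift DY.rest DX.main
  have h6 := (Linear.homCongr k DX.iso (S.functor.mapIso DY.iso)).finrank_eq
  rw [finrank_hom_of_biprod, finrank_hom_to_map_biprod, finrank_hom_to_map_biprod] at h6
  rw [Decomposition.M, Decomposition.M, h1, h2, h3, show Module.finrank k (ExtD S.functor X Y) = _ from h6]
  omega

end Formula

end HigherAngulated

end

open HigherAngulated
theorem proposition2p7
    {k : Type v} [Field k] [IsAlgClosed k]
    {C : Type u} [Category.{v} C] [Preadditive C] [Linear k C] [HomFinite k C]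
    [HasFiniteBiproducts C] [IsIdempotentComplete C]
    (d : ℕ) (hd : 1 ≤ d)
    (S : C ≌ C) [S.functor.Additive] [S.functor.Linear k]
    (𝒜 : Angulation S.functor d)
    (hCY : IsTwiceCalabiYau k S.functor)
    (T : C) (hT : IsClusterTilting 𝒜 T)
    (X Y : C) (DX : Decomposition S.functor T X) (DY : Decomposition S.functor T Y) :
    Module.rank k (ExtD S.functor X Y) =
        Module.rank k (DX.M k ⟶ tauD k d (DY.M k))
        + Module.rank k (DY.M k ⟶ tauD k d (DX.M k))
        + Module.rank k (DX.P k ⟶ DY.M k)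
        + Module.rank k (DY.P k ⟶ DX.M k) ∧
    (Subsingleton (ExtD S.functor X Y) ↔
      Subsingleton (DX.M k ⟶ tauD k d (DY.M k)) ∧
      Subsingleton (DY.M k ⟶ tauD k d (DX.M k)) ∧
      Subsingleton (DX.P k ⟶ DY.M k) ∧
      Subsingleton (DY.P k ⟶ DX.M k)) := by
  have hfin := fun M N : FGModuleCat.{v} (End T)ᵐᵒᵖ => finite_fgHom k M N
  have := HomFinite.finite_hom (k := k) X (S.functor.obj Y)
  have h : Module.rank k (ExtD S.functor X Y) =
        Module.rank k (DX.M k ⟶ tauD k d (DY.M k))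
        + Module.rank k (DY.M k ⟶ tauD k d (DX.M k))
        + Module.rank k (DX.P k ⟶ DY.M k)
        + Module.rank k (DY.P k ⟶ DX.M k) := by
    simp only [← Module.finrank_eq_rank]
    exact_mod_cast finrank_extD hd 𝒜 hCY hT DX DY
  refine ⟨h, ?_⟩
  simp only [← rank_zero_iff (R := k), h, add_eq_zero, and_assoc]
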